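/- Write points of $\mathbb{R}^{n+m}$ as $\mathbf z=(x,y)$ with $x\in\mathbb{R}^n$, $y\in\mathbb{R}^m$, with the Euclidean metric. Let $K\subseteq\mathbb{R}^{n+m}$ be closed and convex, and let $\varphi$ be a real function on $\mathbb{R}^{n+m}$ that is $C^2$ in a neighbourhood of each point of $K$ and concave-convex on $K$. The latter means: there is a convex set $D\supseteq K$, whose affine hull is the product of an affine subspace of $\mathbb{R}^n$ and one of $\mathbb{R}^m$, such that $x\mapsto\varphi(x,y)$ is concave on $\{x:(x,y)\in D\}$ for every $y$ and $y\mapsto\varphi(x,y)$ is convex on $\{y:(x,y)\in D\}$ for every $x$. (If $K$ has interior points or $K=X\times Y$, one can take $D=K$.) Put $\mathbf f=(\varphi_x,-\varphi_y)$ and, for $\mathbf z\in K$, let $N_K(\mathbf z)=\{\mathbf v:\mathbf v^T(\mathbf w-\mathbf z)\le 0\ \forall\,\mathbf w\in K\}$ be the normal cone, and $\mathbf P_{C}$ the projection onto a closed convex set $C$. A trajectory of the subgradient method on $K$, on a time interval $I\subseteq\mathbb{R}$, is a locally absolutely continuous $\mathbf z:I\to K$ with $$\dot{\mathbf z}(t)=\mathbf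 f(\mathbf z(t))-\mathbf P_{N_K(\mathbf z(t))}\big(\mathbf f(\mathbf z(t))\big)\quad\text{for almost every }t\in I.$$ An equilibrium point is a constant trajectory. The method is globally convergent if for every trajectory $\mathbf z$ on $[0,\infty)$ the distance from $\mathbf z(t)$ to the set of equilibrium points tends to $0$ as $t\to\infty$. A point $\bar{\mathbf z}=(\bar x,\bar y)\in K$ is a $K$-restricted saddle point of $\varphi$ if $\mathbf f(\bar{\mathbf z})\in N_K(\bar{\mathbf z})$; for $K=X\times Y$ this says that $\varphi(x,\bar y)\le\varphi(\bar x,\bar y)\le\varphi(\bar x,y)$ for all $x\in X$, $y\in Y$. A face of $K$ is a convex subset of $K$ that contains every line segment in $K$ whose relative interior it meets. Let $F$ be the minimal face of $K$ that contains all $K$-restricted saddle points (the intersection of all faces that contain them), let $V$ be the affine span of $F$ and $N_V$ its normal cone, and let $\Pi$ be the orthogonal projection onto the orthogonal complement of $N_V$. Let $$A(\mathbf z)=\begin{bmatrix}0&\varphi_{xy}(\mathbf z)\\-\varphi_{yx}(\mathbf z)&0\end{bmatrix},\qquad B(\mathbf z)=\begin{bmatrix}\varphi_{xx}(\mathbf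 z)&0\\0&-\varphi_{yy}(\mathbf z)\end{bmatrix}.$$ Theorem. Suppose that $\mathbf 0\in K$ is a $K$-restricted saddle point of $\varphi$, and that the subgradient method on $K$ applied to $\varphi$ has no non-constant trajectory $\mathbf z:\mathbb{R}\to K$ with both (i) $\dot{\mathbf z}(t)=\Pi A(\mathbf 0)\Pi\,\mathbf z(t)$ for all $t\in\mathbb{R}$, and (ii) $\mathbf z(t)\in\ker\big(\Pi B(r\mathbf z(t))\Pi\big)\cap\ker\big(\Pi(A(r\mathbf z(t))-A(\mathbf 0))\Pi\big)$ for all $r\in[0,1]$ and $t\in\mathbb{R}$. Then the subgradient method on $K$ is globally convergent. -/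

import Mathlib

open Set MeasureTheory

namespace Subgradient

/-- `ℝ^{n+m}` with its Euclidean metric; the first `n` coordinates are `x`, the last `m` are `y`. -/
abbrev E (n m : ℕ) : Type := EuclideanSpace ℝ (Fin n ⊕ Fin m)

variable {n m : ℕ}

/-- The point `(x, y)` of `ℝ^{n+m}`. -/
def pt (x : EuclideanSpace ℝ (Fin n)) (y : EuclideanSpace ℝ (Fin m)) : E n m :=
  WithLp.toLp 2 (Sum.elim (fun i => x i) (fun j => y j))

/-- The `x`-component of a point of `ℝ^{n+m}`. -/
def xPart (z : E n m) : EuclideanSpace ℝ (Fin n) := WithLp.toLp 2 (fun i => z (Sum.inl i))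

/-- The `y`-component of a point of `ℝ^{n+m}`. -/
def yPart (z : E n m) : EuclideanSpace ℝ (Fin m) := WithLp.toLp 2 (fun j => z (Sum.inr j))

/-- The first partial derivative of `φ` at `z` in the coordinate `k`. -/
noncomputable def pderiv (φ : E n m → ℝ) (k : Fin n ⊕ Fin m) (z : E n m) : ℝ :=
  fderiv ℝ φ z (EuclideanSpace.single k 1)

/-- The vector field `f = (φ_x, -φ_y)`. -/
noncomputable def field (φ : E n m → ℝ) (z : E n m) : E n m :=
  WithLp.toLp 2 (Sum.elim (fun i => pderiv φ (Sum.inl i) z) (fun j => -pderiv φ (Sum.inr j) z))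

/-- The matrix of second partial derivatives of `φ` at `z`. -/
noncomputable def hess (φ : E n m → ℝ) (z : E n m) :
    Matrix (Fin n ⊕ Fin m) (Fin n ⊕ Fin m) ℝ :=
  Matrix.of fun k l => pderiv (pderiv φ l) k z

/-- `A(z) = [0, φ_xy(z); -φ_yx(z), 0]`. -/
noncomputable def matA (φ : E n m → ℝ) (z : E n m) :
    Matrix (Fin n ⊕ Fin m) (Fin n ⊕ Fin m) ℝ :=
  Matrix.fromBlocks 0 (hess φ z).toBlocks₁₂ (-(hess φ z).toBlocks₂₁) 0

/-- `B(z) = [φ_xx(z), 0; 0, -φ_yy(z)]`. -/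
noncomputable def matB (φ : E n m → ℝ) (z : E n m) :
    Matrix (Fin n ⊕ Fin m) (Fin n ⊕ Fin m) ℝ :=
  Matrix.fromBlocks (hess φ z).toBlocks₁₁ 0 0 (-(hess φ z).toBlocks₂₂)

/-- On the set `D`, `φ` is concave in `x` for each fixed `y` and convex in `y` for each fixed `x`. -/
def SlicewiseConcaveConvex (φ : E n m → ℝ) (D : Set (E n m)) : Prop :=
  (∀ y, ConcaveOn ℝ {x | pt x y ∈ D} (fun x => φ (pt x y))) ∧
  (∀ x, ConvexOn ℝ {y | pt x y ∈ D} (fun y => φ (pt x y)))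

/-- `φ` is concave-convex on `K`: it is concave in `x` and convex in `y` on a convex set `D ⊇ K`
whose affine hull is the product of an affine subspace of `ℝ^n` and one of `ℝ^m` (the direction of
the affine hull contains `(v_x, 0)` with every `(v_x, v_y)`). If the affine hull of `K` is itself
such a product, in particular if `K` has interior points or is a product of convex sets, then
`D = K` can be taken (see the facts below); `D = ℝ^{n+m}` is the case where `φ` is concave-convex
everywhere. On a `K` like a diagonal line all slices are points, so the slices of `K` alone would
say nothing. -/
def ConcaveConvexOn (φ : E n m → ℝ) (K : Set (E n m)) : Prop :=
  ∃ D : Set (E n m), Convex ℝ D ∧ K ⊆ D ∧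
    (∀ v ∈ vectorSpan ℝ D, pt (xPart v) 0 ∈ vectorSpan ℝ D) ∧ SlicewiseConcaveConvex φ D

/-- The normal cone to `K` through `z`. -/
def normalCone (K : Set (E n m)) (z : E n m) : Set (E n m) :=
  {v | ∀ w ∈ K, inner ℝ v (w - z) ≤ 0}

/-- `p` is the projection of `v` onto `C`, the point of `C` nearest to `v`
(unique if `C` is convex). -/
def IsProjection (C : Set (E n m)) (v p : E n m) : Prop :=
  p ∈ C ∧ ∀ q ∈ C, dist v p ≤ dist v q

/-- `z̄` is a `K`-restricted saddle point of `φ`: `z̄ ∈ K` and `(φ_x(z̄), -φ_y(z̄)) ∈ N_K(z̄)`.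
For `K = X × Y` this says `φ(x, ȳ) ≤ φ(x̄, ȳ) ≤ φ(x̄, y)` for all `x ∈ X`, `y ∈ Y`
(`isRestrictedSaddle_prod_iff`). -/
def IsRestrictedSaddle (φ : E n m → ℝ) (K : Set (E n m)) (z : E n m) : Prop :=
  z ∈ K ∧ field φ z ∈ normalCone K z

/-- A face of `K`: a convex subset that contains every segment of `K` of which it contains
a relative interior point. -/
def IsFace (K F : Set (E n m)) : Prop := Convex ℝ F ∧ IsExtreme ℝ K F

/-- The minimal face of `K` containing `A`. -/
def minimalFace (K A : Set (E n m)) : Set (E n m) := ⋂₀ {F | IsFace K F ∧ A ⊆ F}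

/-- The affine span `V` of the minimal face of `K` that contains all `K`-restricted saddles. -/
noncomputable def faceSpan (φ : E n m → ℝ) (K : Set (E n m)) : AffineSubspace ℝ (E n m) :=
  affineSpan ℝ (minimalFace K {z | IsRestrictedSaddle φ K z})

/-- The orthogonal projection `Π` onto the orthogonal complement of `N_V`. Here `0 ∈ V`, and the
normal cone of an affine subspace is the same at all its points. -/
noncomputable def proj (φ : E n m → ℝ) (K : Set (E n m)) : E n m →ₗ[ℝ] E n m :=
  ((Submodule.span ℝ (normalCone (faceSpan φ K : Set (E n m)) 0))ᗮ).starProjection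

/-- `Π M Π` as a linear map. -/
noncomputable def compress (φ : E n m → ℝ) (K : Set (E n m))
    (M : Matrix (Fin n ⊕ Fin m) (Fin n ⊕ Fin m) ℝ) : E n m →ₗ[ℝ] E n m :=
  proj φ K ∘ₗ Matrix.toEuclideanLin M ∘ₗ proj φ K

/-- `z` is, on the time interval `I`, a trajectory of the subgradient method on `K` applied to `φ`:
a Carathéodory solution in `K` of `ż = f(z) - P_{N_K(z)}(f(z))`. -/
def IsTrajectory (φ : E n m → ℝ) (K : Set (E n m)) (I : Set ℝ) (z : ℝ → E n m) : Prop :=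
  (∀ t ∈ I, z t ∈ K) ∧
  (∀ a b : ℝ, a ≤ b → Icc a b ⊆ I → AbsolutelyContinuousOnInterval z a b) ∧
  ∀ᵐ t ∂(volume.restrict I), ∃ p, IsProjection (normalCone K (z t)) (field φ (z t)) p ∧
    HasDerivAt z (field φ (z t) - p) t

/-- Equilibrium points of the subgradient method: constant trajectories. -/
def IsEquilibrium (φ : E n m → ℝ) (K : Set (E n m)) (e : E n m) : Prop :=
  IsTrajectory φ K (Ici 0) (fun _ => e)

/-- Global convergence of the subgradient method: every trajectory, from whatever initial point
of `K`, converges to the set of equilibrium points as `t → ∞`. -/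
def GloballyConvergent (φ : E n m → ℝ) (K : Set (E n m)) : Prop :=
  ∀ z : ℝ → E n m, IsTrajectory φ K (Ici 0) z →
    ∀ ε > 0, ∃ T : ℝ, ∀ t ≥ T, ∃ e, IsEquilibrium φ K e ∧ dist (z t) e < ε

/-! Facts that relate the definitions to the usual ones for the most common sets `K`. -/

theorem pt_parts (z : E n m) : pt (xPart z) (yPart z) = z := by
  ext k; cases k <;> rfl

theorem xPart_pt (x : EuclideanSpace ℝ (Fin n)) (y : EuclideanSpace ℝ (Fin m)) :
    xPart (pt x y) = x := rfl

theorem yPart_pt (x : EuclideanSpace ℝ (Fin n)) (y : EuclideanSpace ℝ (Fin m)) :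
    yPart (pt x y) = y := rfl

theorem pt_combo (x x' : EuclideanSpace ℝ (Fin n)) (y y' : EuclideanSpace ℝ (Fin m)) (a b : ℝ) :
    a • pt x y + b • pt x' y' = pt (a • x + b • x') (a • y + b • y') := by
  ext k; cases k <;> rfl

/-- `X × Y` as a subset of `ℝ^{n+m}`. -/
def prodSet (X : Set (EuclideanSpace ℝ (Fin n))) (Y : Set (EuclideanSpace ℝ (Fin m))) :
    Set (E n m) := {z | xPart z ∈ X ∧ yPart z ∈ Y}

theorem vectorSpan_prodSet (X : Set (EuclideanSpace ℝ (Fin n)))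
    (Y : Set (EuclideanSpace ℝ (Fin m))) (v : E n m) (hv : v ∈ vectorSpan ℝ (prodSet X Y)) :
    pt (xPart v) 0 ∈ vectorSpan ℝ (prodSet X Y) := by
  unfold vectorSpan at hv ⊢
  induction hv using Submodule.span_induction with
  | mem v hv =>
    obtain ⟨z, hz, w, hw, rfl⟩ := hv
    have hp : pt (xPart w) (yPart z) ∈ prodSet X Y := ⟨hw.1, hz.2⟩
    have he : pt (xPart (z - w)) 0 = z - pt (xPart w) (yPart z) := by
      ext k; cases k <;> simp [pt, xPart, yPart]
    exact he ▸ Submodule.subset_span (Set.vsub_mem_vsub hz hp)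
  | zero =>
    convert Submodule.zero_mem _ using 1
    ext k; cases k <;> simp [pt, xPart]
  | add u w _ _ hu hw =>
    convert Submodule.add_mem _ hu hw using 1
    ext k; cases k <;> simp [pt, xPart]
  | smul c u _ hu =>
    convert Submodule.smul_mem _ c hu using 1
    ext k; cases k <;> simp [pt, xPart]

/-- If the convex set `K` has an interior point or is a product, then concave-convexity on `K` is
the condition on the slices of `K`. -/
theorem concaveConvexOn_iff {φ : E n m → ℝ} {K : Set (E n m)} (hK : Convex ℝ K)
    (h : (interior K).Nonempty ∨ ∃ X Y, K = prodSet X Y) :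
    ConcaveConvexOn φ K ↔ SlicewiseConcaveConvex φ K := by
  have h' : ∀ v ∈ vectorSpan ℝ K, pt (xPart v) 0 ∈ vectorSpan ℝ K := by
    rcases h with h | ⟨X, Y, rfl⟩
    · intro v _
      have := (hK.interior_nonempty_iff_affineSpan_eq_top).1 h
      rw [← direction_affineSpan, this, AffineSubspace.direction_top]
      trivial
    · exact vectorSpan_prodSet X Y
  constructor
  · rintro ⟨D, _, hKD, _, h1, h2⟩
    refine ⟨fun y => (h1 y).subset (fun x hx => hKD hx) ?_,
      fun x => (h2 x).subset (fun y hy => hKD hy) ?_⟩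
    · intro x hx x' hx' a b ha hb hab
      have := hK hx hx' ha hb hab
      rwa [pt_combo, ← add_smul, hab, one_smul] at this
    · intro y hy y' hy' a b ha hb hab
      have := hK hy hy' ha hb hab
      rwa [pt_combo, ← add_smul, hab, one_smul] at this
  · exact fun hs => ⟨K, hK, subset_rfl, h', hs⟩

theorem inner_field (φ : E n m → ℝ) (z v : E n m) :
    inner ℝ (field φ z) v = fderiv ℝ φ z (pt (xPart v) 0) - fderiv ℝ φ z (pt 0 (yPart v)) := by
  have key : ∀ u : E n m, fderiv ℝ φ z u = ∑ k, u k * pderiv φ k z := by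
    intro u
    conv_lhs => rw [← (EuclideanSpace.basisFun (Fin n ⊕ Fin m) ℝ).sum_repr u]
    simp [pderiv]
  rw [key, key]
  simp [field, PiLp.inner_apply, pt, xPart, yPart, Fintype.sum_sum_type, sub_eq_add_neg]

theorem fderiv_le_sub {ψ : E n m → ℝ} {z w : E n m} (hd : DifferentiableAt ℝ ψ z)
    (hc : ConvexOn ℝ (segment ℝ z w) ψ) : fderiv ℝ ψ z (w - z) ≤ ψ w - ψ z := by
  have h1 : HasDerivAt (fun s : ℝ => ψ (AffineMap.lineMap z w s)) (fderiv ℝ ψ z (w - z)) 0 := by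
    have h2 : HasDerivAt (fun s : ℝ => AffineMap.lineMap z w s) (w - z) 0 :=
      AffineMap.hasDerivAt_lineMap
    have h3 : HasFDerivAt ψ (fderiv ℝ ψ z) (AffineMap.lineMap z w (0 : ℝ)) := by
      simpa using hd.hasFDerivAt
    exact h3.comp_hasDerivAt 0 h2
  have h4 : ConvexOn ℝ (Icc (0 : ℝ) 1) (fun s : ℝ => ψ (AffineMap.lineMap z w s)) := by
    refine (hc.comp_affineMap (AffineMap.lineMap z w)).subset ?_ (convex_Icc 0 1)
    intro s hs
    rw [segment_eq_image_lineMap]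
    exact mem_image_of_mem _ hs
  simpa [slope] using h4.le_slope_of_hasDerivAt (by simp) (by simp) one_pos h1

theorem fderiv_nonneg {ψ : E n m → ℝ} {z w : E n m} (hd : DifferentiableAt ℝ ψ z)
    (hm : ∀ u ∈ segment ℝ z w, ψ z ≤ ψ u) : 0 ≤ fderiv ℝ ψ z (w - z) :=
  IsLocalMinOn.hasFDerivWithinAt_nonneg (s := segment ℝ z w)
    (Filter.eventually_of_mem self_mem_nhdsWithin hm) hd.hasFDerivAt.hasFDerivWithinAt
    (sub_mem_posTangentConeAt_of_segment_subset subset_rfl)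

theorem convexOn_segment {ψ : E n m → ℝ} {S : Set (E n m)} {z w : E n m} (hz : z ∈ S) (hw : w ∈ S)
    (h : ConvexOn ℝ S ψ) : ConvexOn ℝ (segment ℝ z w) ψ :=
  h.subset (h.1.segment_subset hz hw) (convex_segment _ _)

/-- On a product of convex sets the restricted saddle points are the points that satisfy the
saddle inequalities on the slices. -/
theorem isRestrictedSaddle_prod_iff {φ : E n m → ℝ} {X : Set (EuclideanSpace ℝ (Fin n))}
    {Y : Set (EuclideanSpace ℝ (Fin m))} (hX : Convex ℝ X) (hY : Convex ℝ Y) {z : E n m}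
    (hz : z ∈ prodSet X Y) (hd : DifferentiableAt ℝ φ z)
    (hcc : SlicewiseConcaveConvex φ (prodSet X Y)) :
    IsRestrictedSaddle φ (prodSet X Y) z ↔
      ∀ x y, pt x (yPart z) ∈ prodSet X Y → pt (xPart z) y ∈ prodSet X Y →
        φ (pt x (yPart z)) ≤ φ z ∧ φ z ≤ φ (pt (xPart z) y) := by
  have hxs : ∀ w : E n m, pt (xPart w) (yPart z) - z = pt (xPart (w - z)) 0 := by
    intro w; ext k; cases k <;> simp [pt, xPart, yPart]
  have hys : ∀ w : E n m, pt (xPart z) (yPart w) - z = pt 0 (yPart (w - z)) := by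
    intro w; ext k; cases k <;> simp [pt, xPart, yPart]
  have hsegx : ∀ x, ∀ u ∈ segment ℝ z (pt x (yPart z)), ∃ x', x' ∈ segment ℝ (xPart z) x ∧
      u = pt x' (yPart z) := by
    rintro x u ⟨a, b, ha, hb, hab, rfl⟩
    refine ⟨_, ⟨a, b, ha, hb, hab, rfl⟩, ?_⟩
    conv_lhs => rw [← pt_parts z]
    simp only [pt_combo, yPart_pt, ← add_smul, hab, one_smul]
  have hsegy : ∀ y, ∀ u ∈ segment ℝ z (pt (xPart z) y), ∃ y', y' ∈ segment ℝ (yPart z) y ∧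
      u = pt (xPart z) y' := by
    rintro y u ⟨a, b, ha, hb, hab, rfl⟩
    refine ⟨_, ⟨a, b, ha, hb, hab, rfl⟩, ?_⟩
    conv_lhs => rw [← pt_parts z]
    simp only [pt_combo, xPart_pt, ← add_smul, hab, one_smul]
  have hdn : DifferentiableAt ℝ (fun u => -φ u) z := hd.neg
  have hfn : fderiv ℝ (fun u => -φ u) z = -fderiv ℝ φ z := fderiv_fun_neg
  constructor
  · rintro ⟨_, hN⟩ x y hx hy
    constructor
    · have h1 : ConvexOn ℝ (segment ℝ z (pt x (yPart z))) (fun u => -φ u) := by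
        refine ⟨convex_segment _ _, ?_⟩
        intro u hu v hv a b ha hb hab
        obtain ⟨x1, hx1, rfl⟩ := hsegx x u hu
        obtain ⟨x2, hx2, rfl⟩ := hsegx x v hv
        have := (hcc.1 (yPart z)).2 (x := x1) ⟨hX.segment_subset hz.1 hx.1 hx1, hz.2⟩
          (y := x2) ⟨hX.segment_subset hz.1 hx.1 hx2, hz.2⟩ ha hb hab
        rw [pt_combo, ← add_smul, hab, one_smul]
        simp only [smul_eq_mul] at this ⊢
        linarith
      have h2 := fderiv_le_sub hdn h1
      have h3 := hN _ hx
      rw [inner_field] at h3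
      have h4 := hxs (pt x (yPart z))
      have h5 : (pt 0 (yPart (pt x (yPart z) - z)) : E n m) = 0 := by
        ext k; cases k <;> simp [pt, yPart]
      rw [xPart_pt] at h4
      rw [h5, map_zero, ← h4] at h3
      rw [hfn] at h2
      simp only [neg_apply] at h2
      linarith
    · have h1 : ConvexOn ℝ (segment ℝ z (pt (xPart z) y)) φ := by
        refine ⟨convex_segment _ _, ?_⟩
        intro u hu v hv a b ha hb hab
        obtain ⟨y1, hy1, rfl⟩ := hsegy y u hu
        obtain ⟨y2, hy2, rfl⟩ := hsegy y v hv
        have := (hcc.2 (xPart z)).2 (x := y1) ⟨hz.1, hY.segment_subset hz.2 hy.2 hy1⟩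
          (y := y2) ⟨hz.1, hY.segment_subset hz.2 hy.2 hy2⟩ ha hb hab
        rw [pt_combo, ← add_smul, hab, one_smul]
        exact this
      have h2 := fderiv_le_sub hd h1
      have h3 := hN _ hy
      rw [inner_field] at h3
      have h4 := hys (pt (xPart z) y)
      have h5 : (pt (xPart (pt (xPart z) y - z)) 0 : E n m) = 0 := by
        ext k; cases k <;> simp [pt, xPart]
      rw [yPart_pt] at h4
      rw [h5, map_zero, ← h4] at h3
      linarith
  · intro h
    refine ⟨hz, fun w hw => ?_⟩
    rw [inner_field, ← hxs, ← hys]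
    have h1 := fderiv_nonneg (w := pt (xPart w) (yPart z)) hdn (fun u hu => by
      obtain ⟨x', hx', rfl⟩ := hsegx _ u hu
      have := (h x' (yPart z) ⟨hX.segment_subset hz.1 hw.1 hx', hz.2⟩ hz).1
      simpa using this)
    have h2 := fderiv_nonneg (w := pt (xPart z) (yPart w)) hd (fun u hu => by
      obtain ⟨y', hy', rfl⟩ := hsegy _ u hu
      exact (h (xPart z) y' hz ⟨hz.1, hY.segment_subset hz.2 hw.2 hy'⟩).2)
    rw [hfn] at h1
    simp only [neg_apply] at h1
    linarith

end Subgradient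

open Subgradient

/-! Concave-convexity makes `-field φ` a monotone operator on `K`, so the flow is nonexpansive
(`IsSolution.norm_sub_le`) and distances to saddle points never increase. If a trajectory is away
from the equilibria at arbitrarily late times, limits of its translates form a non-constant solution
`w` on all of ℝ, with constant distance to every saddle point and with isometric time shifts.

The isometry makes `w` return near each of its points with positive density. So each `w t`, up to a
small error, enters with positive weight in a limit of time means of `w`, and such a limit is a
saddle point (`IsSolution.exists_mean`). By extremality `w` stays in the space W of directions of
the minimal face. Take a saddle point `e` in the relative interior of the set of saddle points.
Since `‖w - e‖` is constant, the normal force is orthogonal to W, and `w' = P_W f(w)`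
(`IsSolution.hasDerivAt_proj`).

Constant distances to `0` and `e` also give `f(w) ⟂ w` and `f(w) ⟂ e`, and monotonicity then forces
`P_W f` to be linear on the segment from `0` to `w` (`proj_smul_eq`). Differentiating gives `P_W
(A(rw) + B(rw)) w = P_W f(w)` for all `r` in `[0,1]`. As A is skew and B is negative semidefinite on
W, the B-term vanishes and the A-term does not depend on `r` (`compress_eq_of_linear`). So `w` is a
trajectory of the excluded kind. -/

namespace Subgradient

open Filter Topology

/-! ### Solutions of the projected dynamics: contraction, integral inequalities, Minty's trick. -/

section Dynamics

variable {H : Type*} [NormedAddCommGroup H] [InnerProductSpace ℝ H]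

theorem _root_.LipschitzWith.comp_absolutelyContinuousOnInterval {X Y : Type*}
    [PseudoMetricSpace X] [PseudoMetricSpace Y] {g : X → Y} {C : NNReal} (hg : LipschitzWith C g)
    {z : ℝ → X} {a b : ℝ} (hz : AbsolutelyContinuousOnInterval z a b) :
    AbsolutelyContinuousOnInterval (fun t => g (z t)) a b := by
  unfold AbsolutelyContinuousOnInterval at hz ⊢
  refine squeeze_zero (fun _ => Finset.sum_nonneg fun _ _ => dist_nonneg) (fun p => ?_)
    (by simpa using hz.const_mul (C : ℝ))
  rw [Finset.mul_sum]
  exact Finset.sum_le_sum fun i _ => hg.dist_le_mul _ _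

theorem absolutelyContinuousOnInterval_norm_sq {H : Type*} [NormedAddCommGroup H] {z : ℝ → H} {a b : ℝ}
    (hz : AbsolutelyContinuousOnInterval z a b) :
    AbsolutelyContinuousOnInterval (fun t => ‖z t‖ ^ 2) a b := by
  have h := lipschitzWith_one_norm.comp_absolutelyContinuousOnInterval hz
  simpa [sq] using h.fun_mul h

/-- A differential inequality that holds almost everywhere can be integrated if the function is
absolutely continuous. -/
theorem sub_le_integral_of_ae_hasDerivAt_le {g h : ℝ → ℝ} {a b : ℝ} (hab : a ≤ b)
    (hg : AbsolutelyContinuousOnInterval g a b) (hh : IntervalIntegrable h volume a b)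
    (hd : ∀ᵐ t, t ∈ Icc a b → ∃ g', HasDerivAt g g' t ∧ g' ≤ h t) :
    g b - g a ≤ ∫ t in a..b, h t := by
  rw [← hg.integral_deriv_eq_sub]
  refine intervalIntegral.integral_mono_ae_restrict hab hg.intervalIntegrable_deriv hh ?_
  refine (ae_restrict_iff' measurableSet_Icc).2 ?_
  filter_upwards [hd] with t ht htab
  obtain ⟨g', h1, h2⟩ := ht htab
  rwa [h1.deriv]

/-- `z` is an absolutely continuous curve in `K` with `f(z) - ż` in the normal cone of `K` at `z`
for almost every time in `I`. -/
def IsSolution (f : H → H) (K : Set H) (I : Set ℝ) (z : ℝ → H) : Prop :=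
  (∀ t ∈ I, z t ∈ K) ∧
  (∀ a b : ℝ, a ≤ b → Icc a b ⊆ I → AbsolutelyContinuousOnInterval z a b) ∧
  ∀ᵐ t ∂(volume.restrict I), ∃ d, HasDerivAt z d t ∧ ∀ u ∈ K, inner ℝ (f (z t) - d) (u - z t) ≤ 0

/-- The solutions of the variational inequality of `f` on `K`. -/
def saddles (f : H → H) (K : Set H) : Set H := {e | e ∈ K ∧ ∀ u ∈ K, inner ℝ (f e) (u - e) ≤ 0}

/-- `-f` is a monotone operator on `K`. -/
def IsDissipativeOn (f : H → H) (K : Set H) : Prop :=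
  ∀ u ∈ K, ∀ v ∈ K, inner ℝ (f u - f v) (u - v) ≤ 0

variable {f : H → H} {K : Set H} {I : Set ℝ} {z w : ℝ → H}

theorem IsSolution.ae_Icc (hz : IsSolution f K I z) {s t : ℝ} (h : Icc s t ⊆ I) :
    ∀ᵐ r, r ∈ Icc s t → ∃ d, HasDerivAt z d r ∧ ∀ u ∈ K, inner ℝ (f (z r) - d) (u - z r) ≤ 0 :=
  (ae_restrict_iff' measurableSet_Icc).1 (ae_restrict_of_ae_restrict_of_subset h hz.2.2)

/-- Each normal-cone inequality is tested at the other curve; added to dissipativity they make the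
derivative of the squared distance nonpositive. -/
theorem IsSolution.norm_sub_le (hf : IsDissipativeOn f K) (hz : IsSolution f K I z)
    (hw : IsSolution f K I w) {s t : ℝ} (hst : s ≤ t) (h : Icc s t ⊆ I) :
    ‖z t - w t‖ ≤ ‖z s - w s‖ := by
  have hac := absolutelyContinuousOnInterval_norm_sq
    ((hz.2.1 s t hst h).fun_sub (hw.2.1 s t hst h))
  have := sub_le_integral_of_ae_hasDerivAt_le (h := fun _ => 0) hst hac
    intervalIntegrable_const (by
      filter_upwards [hz.ae_Icc h, hw.ae_Icc h] with r h1 h2 hr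
      obtain ⟨d, hd, hd'⟩ := h1 hr
      obtain ⟨d2, hd2, hd2'⟩ := h2 hr
      refine ⟨_, (hd.sub hd2).norm_sq, ?_⟩
      have a1 := hd' _ (hw.1 r (h hr))
      have a2 := hd2' _ (hz.1 r (h hr))
      have a3 := hf _ (hz.1 r (h hr)) _ (hw.1 r (h hr))
      simp only [Pi.sub_apply, inner_sub_left, inner_sub_right, real_inner_comm (z r),
        real_inner_comm (w r)] at a1 a2 a3 ⊢
      linarith)
  simp only [intervalIntegral.integral_zero, sub_nonpos] at this
  exact le_of_sq_le_sq this (norm_nonneg _)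

theorem isSolution_const {e : H} (he : e ∈ saddles f K) : IsSolution f K I (fun _ => e) := by
  refine ⟨fun _ _ => he.1, fun a b _ _ => ?_, ae_of_all _ fun t => ⟨0, hasDerivAt_const _ _, ?_⟩⟩
  · exact ((LipschitzWith.const e).lipschitzOnWith (s := uIcc a b)).absolutelyContinuousOnInterval
  · simpa using he.2

/-- Dissipativity replaces `f (z r)` by `f u` with `u` fixed, and the velocity disappears. The
result is affine in `z r` on the right, which suits limits and time means. -/
theorem IsSolution.evi (hf : IsDissipativeOn f K) (hz : IsSolution f K I z) {u : H} (hu : u ∈ K)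
    {s t : ℝ} (hst : s ≤ t) (h : Icc s t ⊆ I) :
    ‖z t - u‖ ^ 2 - ‖z s - u‖ ^ 2 ≤ ∫ r in s..t, 2 * inner ℝ (f u) (z r - u) := by
  have hz' := hz.2.1 s t hst h
  have hc : ContinuousOn z (uIcc s t) := hz'.continuousOn
  have hconst : AbsolutelyContinuousOnInterval (fun _ : ℝ => u) s t :=
    ((LipschitzWith.const u).lipschitzOnWith (s := uIcc s t)).absolutelyContinuousOnInterval
  refine sub_le_integral_of_ae_hasDerivAt_le hst
    (absolutelyContinuousOnInterval_norm_sq (hz'.fun_sub hconst)) ?_ ?_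
  · apply ContinuousOn.intervalIntegrable
    fun_prop
  · filter_upwards [hz.ae_Icc h] with r h1 hr
    obtain ⟨d, hd, hd'⟩ := h1 hr
    refine ⟨_, (hd.sub_const u).norm_sq, ?_⟩
    have a1 := hd' _ hu
    have a3 := hf _ (hz.1 r (h hr)) _ hu
    simp only [inner_sub_left, inner_sub_right, real_inner_comm (z r), real_inner_comm u]
      at a1 a3 ⊢
    linarith

/-- A normal vector is orthogonal to the velocity of a curve in the set. -/
theorem inner_deriv_eq_zero {p d : H} {t : ℝ} (hd : HasDerivAt z d t) (hz : ∀ᶠ r in 𝓝 t, z r ∈ K)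
    (hp : ∀ u ∈ K, inner ℝ p (u - z t) ≤ 0) : inner ℝ p d = 0 := by
  have h1 : HasDerivAt (fun r => inner ℝ p (z r)) (inner ℝ p d) t := by
    simpa using (hasDerivAt_const t p).inner ℝ hd
  refine IsLocalMax.hasDerivAt_eq_zero (f := fun r => inner ℝ p (z r)) ?_ h1
  filter_upwards [hz] with r hr
  have := hp _ hr
  rw [inner_sub_right] at this
  linarith

/-- Almost everywhere `f z - z'` is orthogonal to `z'`, so the speed is at most `‖f z‖`. Pairing
with the fixed increment `ξ` reduces the claim to a scalar function. -/
theorem IsSolution.lipschitz (hz : IsSolution f K I z) {M : ℝ} (hM : ∀ t ∈ I, ‖f (z t)‖ ≤ M)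
    {s t : ℝ} (hst : s ≤ t) (h : Icc s t ⊆ I) : ‖z t - z s‖ ≤ M * (t - s) := by
  set ξ := z t - z s with hξ
  have hM0 : 0 ≤ M := (norm_nonneg _).trans (hM s (h ⟨le_rfl, hst⟩))
  have hac : AbsolutelyContinuousOnInterval (fun r => inner ℝ ξ (z r)) s t :=
    (innerSL ℝ ξ).lipschitz.comp_absolutelyContinuousOnInterval (hz.2.1 s t hst h)
  -- The orthogonality needs the curve to be in `K` on both sides of `r`, hence the endpoints are
  -- left out.
  have hne : ∀ᵐ r : ℝ, r ≠ s ∧ r ≠ t := by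
    have h1 : ∀ x : ℝ, ∀ᵐ r : ℝ, r ≠ x := fun x => by simp [ae_iff]
    filter_upwards [h1 s, h1 t] with r h2 h3 using ⟨h2, h3⟩
  have := sub_le_integral_of_ae_hasDerivAt_le (h := fun _ => ‖ξ‖ * M) hst hac
    intervalIntegrable_const (by
      filter_upwards [hz.ae_Icc h, hne] with r h1 h2 hr
      obtain ⟨d, hd, hd'⟩ := h1 hr
      refine ⟨inner ℝ ξ d, by simpa using (hasDerivAt_const r ξ).inner ℝ hd, ?_⟩
      have hr' : Ioo s t ∈ 𝓝 r :=
        Ioo_mem_nhds (lt_of_le_of_ne hr.1 h2.1.symm) (lt_of_le_of_ne hr.2 h2.2)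
      have h3 := inner_deriv_eq_zero hd (Filter.mem_of_superset hr' fun x hx =>
        hz.1 x (h (Ioo_subset_Icc_self hx))) hd'
      have h4 : ‖d‖ ≤ M := by
        rw [inner_sub_left, real_inner_self_eq_norm_sq] at h3
        have h5 := real_inner_le_norm (f (z r)) d
        have h6 := hM r (h hr)
        by_contra! h7
        nlinarith [norm_nonneg d]
      exact (real_inner_le_norm _ _).trans (by gcongr))
  simp only [intervalIntegral.integral_const, smul_eq_mul] at this
  rw [← inner_sub_right, ← hξ, real_inner_self_eq_norm_sq] at this
  by_contra! h7
  have : 0 < ‖ξ‖ := lt_of_le_of_lt (mul_nonneg hM0 (sub_nonneg.2 hst)) h7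
  nlinarith

theorem lineMap_mem {x y : H} (hK : Convex ℝ K) (hx : x ∈ K) (hy : y ∈ K) {s : ℝ}
    (hs : s ∈ Icc (0 : ℝ) 1) : x + s • (y - x) ∈ K := by
  have := hK.lineMap_mem hx hy hs
  rwa [AffineMap.lineMap_apply, vsub_eq_sub, vadd_eq_add, add_comm] at this

/-- Minty's trick: a variational inequality tested with `f u` can be tested with `f c`. -/
theorem minty (hK : Convex ℝ K) (hfc : ContinuousOn f K) {c d : H} (hc : c ∈ K)
    (h : ∀ u ∈ K, inner ℝ (f u - d) (u - c) ≤ 0) {u : H} (hu : u ∈ K) :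
    inner ℝ (f c - d) (u - c) ≤ 0 := by
  have hcont : ContinuousOn (fun s : ℝ => inner ℝ (f (c + s • (u - c)) - d) (u - c)) (Icc 0 1) := by
    have : ContinuousOn (fun s : ℝ => f (c + s • (u - c))) (Icc 0 1) :=
      hfc.comp (by fun_prop) fun s hs => lineMap_mem hK hc hu hs
    exact (this.sub continuousOn_const).inner continuousOn_const
  have hlim := (hcont 0 (by simp)).mono_left (nhdsWithin_mono 0 Ioc_subset_Icc_self)
  have : (𝓝[Ioc (0 : ℝ) 1] 0).NeBot := by
    rw [nhdsWithin_Ioc_eq_nhdsGT one_pos]; infer_instance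
  simp only [zero_smul, add_zero] at hlim
  refine le_of_tendsto hlim ?_
  filter_upwards [self_mem_nhdsWithin] with s hs
  -- Test at `c + s • (u - c)`, divide by `s`, and let `s` tend to 0.
  have h1 := h _ (lineMap_mem hK hc hu ⟨hs.1.le, hs.2⟩)
  rw [add_sub_cancel_left, inner_smul_right] at h1
  exact nonpos_of_mul_nonpos_right h1 hs.1

/-- In the Minty form the unknown `c` enters each inequality affinely, which gives convexity and
makes limits of means easy to test. -/
theorem saddles_eq (hK : Convex ℝ K) (hfc : ContinuousOn f K) (hf : IsDissipativeOn f K) :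
    saddles f K = {c | c ∈ K ∧ ∀ u ∈ K, inner ℝ (f u) (u - c) ≤ 0} := by
  ext c
  refine and_congr_right fun hc => ⟨fun h u hu => ?_, fun h u hu => ?_⟩
  · have h1 := hf _ hu _ hc
    have h2 := h u hu
    rw [inner_sub_left] at h1
    linarith
  · simpa using minty (d := 0) hK hfc hc (by simpa using h) hu

theorem convex_saddles (hK : Convex ℝ K) (hfc : ContinuousOn f K) (hf : IsDissipativeOn f K) :
    Convex ℝ (saddles f K) := by
  rw [saddles_eq hK hfc hf]
  intro c hc c' hc' a b ha hb hab
  refine ⟨hK hc.1 hc'.1 ha hb hab, fun u hu => ?_⟩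
  have h1 := hc.2 u hu
  have h2 := hc'.2 u hu
  have : u - (a • c + b • c') = a • (u - c) + b • (u - c') := by
    rw [smul_sub, smul_sub, sub_add_sub_comm, ← add_smul, hab, one_smul]
  rw [this, inner_add_right, inner_smul_right, inner_smul_right]
  nlinarith

/-- The hypotheses contain no derivatives and so survive pointwise limits. At a point of
differentiability the quadratic error vanishes to first order, and `minty` restores `f (w t)` in
place of `f u`. -/
theorem isSolution_univ_of_lipschitz [FiniteDimensional ℝ H] (hK : Convex ℝ K)
    (hfc : ContinuousOn f K) {M : ℝ}
    (hw : ∀ t, w t ∈ K) (hM : ∀ s t, s ≤ t → ‖w t - w s‖ ≤ M * (t - s))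
    (h : ∀ u ∈ K, ∀ s t, s ≤ t → ‖w t - u‖ ^ 2 - ‖w s - u‖ ^ 2 ≤
      2 * inner ℝ (f u) (w s - u) * (t - s) + 2 * ‖f u‖ * M * (t - s) ^ 2) :
    IsSolution f K univ w := by
  have hlip : LipschitzWith M.toNNReal w := by
    refine LipschitzWith.of_dist_le_mul fun s t => ?_
    have hM' : M ≤ M.toNNReal := Real.le_coe_toNNReal M
    rcases le_total s t with h1 | h1
    · rw [dist_comm, dist_eq_norm, Real.dist_eq, abs_sub_comm, abs_of_nonneg (sub_nonneg.2 h1)]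
      exact (hM s t h1).trans (by gcongr)
    · rw [dist_eq_norm, Real.dist_eq, abs_of_nonneg (sub_nonneg.2 h1)]
      exact (hM t s h1).trans (by gcongr)
  refine ⟨fun t _ => hw t, fun a b _ _ => hlip.lipschitzOnWith.absolutelyContinuousOnInterval, ?_⟩
  rw [Measure.restrict_univ]
  filter_upwards [hlip.ae_differentiableAt_real] with t ht
  refine ⟨deriv w t, ht.hasDerivAt, fun u hu => ?_⟩
  refine minty hK hfc (hw t) (fun u hu => ?_) hu
  -- This function is 0 at `t` and nonpositive to the right of it, so its derivative at `t` is
  -- nonpositive.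
  have hd : HasDerivAt (fun r => ‖w r - u‖ ^ 2 - ‖w t - u‖ ^ 2 -
      (2 * inner ℝ (f u) (w t - u) * (r - t) + 2 * ‖f u‖ * M * (r - t) ^ 2))
      (2 * inner ℝ (w t - u) (deriv w t) - 2 * inner ℝ (f u) (w t - u)) t := by
    have h1 := ((ht.hasDerivAt.sub_const u).norm_sq).sub_const (‖w t - u‖ ^ 2)
    have h2 := ((hasDerivAt_id t).sub_const t).const_mul (2 * inner ℝ (f u) (w t - u))
    have h3 := (((hasDerivAt_id t).sub_const t).pow 2).const_mul (2 * ‖f u‖ * M)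
    exact (h1.sub (h2.add h3)).congr_deriv (by simp)
  have h4 : (2 * inner ℝ (w t - u) (deriv w t) - 2 * inner ℝ (f u) (w t - u)) ≤ 0 := by
    refine le_of_tendsto (hd.tendsto_slope.mono_left (nhdsGT_le_nhdsNE t)) ?_
    filter_upwards [self_mem_nhdsWithin] with r hr
    have h5 := h u hu t r (le_of_lt hr)
    rw [slope_def_field]
    refine div_nonpos_of_nonpos_of_nonneg ?_ (sub_nonneg.2 (le_of_lt hr))
    simp only [sub_self, mul_zero]
    linarith
  simp only [inner_sub_left, inner_sub_right, real_inner_comm (deriv w t)] at h4 ⊢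
  linarith

/-- The bound on the increment of the distance to `u` that passes to pointwise limits. -/
theorem IsSolution.norm_sq_sub_le (hf : IsDissipativeOn f K) (hz : IsSolution f K I z) {M : ℝ}
    (hM : ∀ t ∈ I, ‖f (z t)‖ ≤ M) {u : H} (hu : u ∈ K) {s t : ℝ} (hst : s ≤ t)
    (h : Icc s t ⊆ I) :
    ‖z t - u‖ ^ 2 - ‖z s - u‖ ^ 2 ≤
      2 * inner ℝ (f u) (z s - u) * (t - s) + 2 * ‖f u‖ * M * (t - s) ^ 2 := by
  refine (hz.evi hf hu hst h).trans ?_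
  have hM0 : 0 ≤ M := (norm_nonneg _).trans (hM s (h ⟨le_rfl, hst⟩))
  have hc : ContinuousOn z (uIcc s t) := (hz.2.1 s t hst h).continuousOn
  -- Freezing `z r` at `z s` costs at most `M * (t - s)` in norm.
  have : ∫ r in s..t, 2 * inner ℝ (f u) (z r - u) ≤
      ∫ r in s..t, (2 * inner ℝ (f u) (z s - u) + 2 * ‖f u‖ * M * (t - s)) := by
    refine intervalIntegral.integral_mono_on hst ?_ intervalIntegrable_const fun r hr => ?_
    · apply ContinuousOn.intervalIntegrable
      fun_prop
    · have h1 := hz.lipschitz hM hr.1 ((Icc_subset_Icc_right hr.2).trans h)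
      have h2 : inner ℝ (f u) (z r - z s) ≤ ‖f u‖ * (M * (t - s)) :=
        (real_inner_le_norm _ _).trans (by
          gcongr
          exact h1.trans (by gcongr; exact hr.2))
      have h3 : z r - u = (z r - z s) + (z s - u) := by abel
      rw [h3, inner_add_right]
      linarith
  refine this.trans (le_of_eq ?_)
  rw [intervalIntegral.integral_const, smul_eq_mul]
  ring

end Dynamics

/-! ### Limit solutions, recurrence and time means. -/

section Limits

variable {H : Type*} [NormedAddCommGroup H] [InnerProductSpace ℝ H] {f : H → H} {K : Set H}
  {z w : ℝ → H}

theorem _root_.AbsolutelyContinuousOnInterval.comp_add_const {X : Type*} [PseudoMetricSpace X]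
    {g : ℝ → X} {a b c : ℝ} (hg : AbsolutelyContinuousOnInterval g (a + c) (b + c)) :
    AbsolutelyContinuousOnInterval (fun t => g (t + c)) a b := by
  rw [absolutelyContinuousOnInterval_iff] at hg ⊢
  intro ε hε
  obtain ⟨δ, hδ, h⟩ := hg ε hε
  refine ⟨δ, hδ, fun E hE hE2 => h (E.1, fun i => ((E.2 i).1 + c, (E.2 i).2 + c))
    ⟨fun i hi => ?_, ?_⟩ (by simpa using hE2)⟩
  · have := hE.1 i hi
    simp only [uIcc, min_add_add_right, max_add_add_right, mem_Icc, add_le_add_iff_right] at this ⊢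
    exact this
  · intro i hi j hj hij
    have h4 := hE.2 hi hj hij
    simp only [Function.onFun, disjoint_left] at h4 ⊢
    intro x hx hx'
    simp only [uIoc, mem_Ioc, min_add_add_right, max_add_add_right] at hx hx' h4
    refine @h4 (x - c) ?_ ?_ <;> constructor <;> linarith [hx.1, hx.2, hx'.1, hx'.2]

theorem IsSolution.comp_add_const {I J : Set ℝ} (hz : IsSolution f K I z) {c : ℝ}
    (hI : MeasurableSet I) (hJ : MeasurableSet J) (hJI : ∀ r ∈ J, r + c ∈ I) :
    IsSolution f K J (fun r => z (r + c)) := by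
  refine ⟨fun r hr => hz.1 _ (hJI r hr), fun a b hab h => ?_, ?_⟩
  · refine (hz.2.1 (a + c) (b + c) (by linarith) fun x hx => ?_).comp_add_const
    simpa using hJI (x - c) (h ⟨by linarith [hx.1], by linarith [hx.2]⟩)
  · have h1 := (ae_restrict_iff' hI).1 hz.2.2
    refine (ae_restrict_iff' hJ).2 ?_
    filter_upwards [(measurePreserving_add_right volume c).quasiMeasurePreserving.ae h1] with r hr hr0
    obtain ⟨d, hd, hd'⟩ := hr (hJI r hr0)
    exact ⟨d, hd.comp_add_const r c, hd'⟩

theorem IsSolution.antitoneOn_dist_shift (hf : IsDissipativeOn f K)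
    (hz : IsSolution f K (Ici 0) z) {c : ℝ} (hc : 0 ≤ c) :
    AntitoneOn (fun r => ‖z (r + c) - z r‖) (Ici 0) := fun _ hs _ _ hst =>
  (hz.comp_add_const measurableSet_Ici measurableSet_Ici fun _ hr => add_nonneg hr hc).norm_sub_le
    hf hz hst fun _ hx => le_trans hs hx.1

theorem tendsto_atTop_of_antitoneOn_nonneg {g : ℝ → ℝ} (hg : AntitoneOn g (Ici 0))
    (h0 : ∀ t, 0 ≤ g t) : ∃ L, Tendsto g atTop (𝓝 L) := by
  have h1 : Antitone fun t => g (max t 0) := fun s t hst =>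
    hg (mem_Ici.2 (le_max_right _ _)) (mem_Ici.2 (le_max_right _ _)) (max_le_max_right 0 hst)
  refine ⟨_, (tendsto_atTop_ciInf h1 ⟨0, ?_⟩).congr' ?_⟩
  · rintro _ ⟨t, rfl⟩
    exact h0 _
  · filter_upwards [eventually_ge_atTop 0] with t ht
    rw [max_eq_left ht]

/-- The distance of `z` to `e` is monotone, hence convergent, and every `w t` realizes the same
limit. -/
theorem IsSolution.norm_sub_const (hf : IsDissipativeOn f K) (hz : IsSolution f K (Ici 0) z)
    {l : Filter ℝ} [NeBot l] (hl : l ≤ atTop)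
    (hw : ∀ t, Tendsto (fun r => z (r + t)) l (𝓝 (w t))) {e : H} (he : e ∈ saddles f K) (t : ℝ) :
    ‖w t - e‖ = ‖w 0 - e‖ := by
  obtain ⟨L, hL⟩ := tendsto_atTop_of_antitoneOn_nonneg (g := fun t => ‖z t - e‖)
    (fun s hs t _ hst => hz.norm_sub_le hf (isSolution_const he) hst fun x hx => le_trans hs hx.1)
    (fun _ => norm_nonneg _)
  have key : ∀ t, ‖w t - e‖ = L := fun t =>
    tendsto_nhds_unique ((hw t).sub_const e).norm
      (hL.comp ((tendsto_atTop_add_const_right _ t tendsto_id).mono_left hl))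
  rw [key, key]

/-- The distance between `z` and its translate by a lag converges, and the limit depends on the lag
`t - s` alone. -/
theorem IsSolution.norm_sub_shift (hf : IsDissipativeOn f K) (hz : IsSolution f K (Ici 0) z)
    {l : Filter ℝ} [NeBot l] (hl : l ≤ atTop)
    (hw : ∀ t, Tendsto (fun r => z (r + t)) l (𝓝 (w t))) (s t c : ℝ) :
    ‖w (t + c) - w (s + c)‖ = ‖w t - w s‖ := by
  wlog hst : s ≤ t generalizing s t
  · rw [norm_sub_rev, this t s (le_of_not_ge hst), norm_sub_rev]
  obtain ⟨L, hL⟩ := tendsto_atTop_of_antitoneOn_nonneg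
    (hz.antitoneOn_dist_shift hf (sub_nonneg.2 hst)) (fun _ => norm_nonneg _)
  have key : ∀ s' t', t' - s' = t - s → ‖w t' - w s'‖ = L := fun s' t' h => by
    refine tendsto_nhds_unique ((hw t').sub (hw s')).norm
      ((hL.comp ((tendsto_atTop_add_const_right _ s' tendsto_id).mono_left hl)).congr fun r => ?_)
    simp only [Function.comp, id]
    rw [← h, add_assoc, add_sub_cancel]
  rw [key _ _ rfl, key _ _ (by ring)]

/-- Translates of a solution subconverge to a solution on the whole time axis. -/
theorem IsSolution.exists_limit [FiniteDimensional ℝ H] (hKc : IsClosed K) (hK : Convex ℝ K)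
    (hfc : ContinuousOn f K) (hf : IsDissipativeOn f K) (hz : IsSolution f K (Ici 0) z) {e : H}
    (he : e ∈ saddles f K) (l : Filter ℝ) [NeBot l] (hl : l ≤ atTop) :
    ∃ U : Ultrafilter ℝ, (U : Filter ℝ) ≤ l ∧ ∃ w : ℝ → H,
      (∀ t, Tendsto (fun r => z (r + t)) U (𝓝 (w t))) ∧ IsSolution f K univ w := by
  set S := K ∩ Metric.closedBall e ‖z 0 - e‖ with hS
  have hSc : IsCompact S := (isCompact_closedBall _ _).inter_left hKc
  have hzS : ∀ t, 0 ≤ t → z t ∈ S := fun t ht => ⟨hz.1 t ht, by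
    rw [mem_closedBall_iff_norm]
    exact hz.norm_sub_le hf (isSolution_const he) ht fun x hx => hx.1⟩
  obtain ⟨M, hM⟩ := hSc.exists_bound_of_continuousOn (hfc.mono inter_subset_left)
  have hM' : ∀ t ∈ Ici (0 : ℝ), ‖f (z t)‖ ≤ M := fun t ht => hM _ (hzS t ht)
  -- An ultrafilter makes all translates converge at once, without a diagonal subsequence.
  let U := Ultrafilter.of l
  have hU : (U : Filter ℝ) ≤ l := Ultrafilter.of_le l
  have hev : ∀ t : ℝ, ∀ᶠ r in (U : Filter ℝ), 0 ≤ r + t := fun t =>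
    (hU.trans hl) (by filter_upwards [eventually_ge_atTop (-t)] with r hr; linarith)
  have hex : ∀ t, ∃ x ∈ S, Tendsto (fun r => z (r + t)) U (𝓝 x) := fun t =>
    isCompact_iff_ultrafilter_le_nhds.1 hSc (U.map fun r => z (r + t)) (by
      rw [le_principal_iff, Ultrafilter.mem_coe, Ultrafilter.mem_map]
      filter_upwards [hev t] with r hr using hzS _ hr)
  choose w hwS hw using hex
  refine ⟨U, hU, w, hw, isSolution_univ_of_lipschitz hK hfc (fun t => (hwS t).1) (M := M) ?_ ?_⟩
  · intro s t hst
    refine le_of_tendsto ((hw t).sub (hw s)).norm ?_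
    filter_upwards [hev s] with r hr
    have := hz.lipschitz hM' (add_le_add_right hst r) fun x hx => le_trans hr hx.1
    rwa [add_sub_add_left_eq_sub] at this
  · intro u hu s t hst
    have h1 := ((hw t).sub_const u).norm.pow 2
    have h2 := ((hw s).sub_const u).norm.pow 2
    have h3 : Tendsto (fun r => inner ℝ (f u) (z (r + s) - u)) U (𝓝 (inner ℝ (f u) (w s - u))) :=
      tendsto_const_nhds.inner ((hw s).sub_const u)
    refine le_of_tendsto_of_tendsto (h1.sub h2)
      (((h3.const_mul 2).mul_const (t - s)).add_const (2 * ‖f u‖ * M * (t - s) ^ 2)) ?_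
    filter_upwards [hev s] with r hr
    have := hz.norm_sq_sub_le hf hM' hu (add_le_add_right hst r) fun x hx => le_trans hr hx.1
    rwa [add_sub_add_left_eq_sub] at this

/-- If all time translations are isometric on the relatively compact orbit of `w`, then the times
of return to a ball about `w 0` have positive lower density. -/
theorem exists_return_density {H : Type*} [NormedAddCommGroup H] {w : ℝ → H} (htb : TotallyBounded (range w))
    (hiso : ∀ s t c, ‖w (t + c) - w (s + c)‖ = ‖w t - w s‖) {δ : ℝ} (hδ : 0 < δ) :
    ∃ a > 0, ∀ᶠ T in atTop, a * T ≤ volume.real (Icc 0 T ∩ {t | ‖w t - w 0‖ ≤ δ}) := by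
  obtain ⟨S, hSw, hSf, hS⟩ := totallyBounded_iff_subset.1 htb _ (Metric.dist_mem_uniformity hδ)
  lift S to Finset H using hSf
  set P := {t | ‖w t - w 0‖ ≤ δ} with hP
  set τ := Function.invFun w with hτ
  have hwτ : ∀ y ∈ S, w (τ y) = y := fun y hy => Function.invFun_eq (hSw hy)
  -- `C` bounds the total length lost when shifts by `τ y` move times out of `[0, T]`.
  set C := ∑ y ∈ S, 2 * |τ y| with hC
  have hC0 : 0 ≤ C := Finset.sum_nonneg fun _ _ => by positivity
  have hcard : 0 < (S.card : ℝ) := by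
    have h1 := hS (mem_range_self 0)
    simp only [mem_iUnion] at h1
    obtain ⟨y, hy, -⟩ := h1
    exact_mod_cast Finset.card_pos.2 ⟨y, hy⟩
  -- The covering yields `T ≤ card * (measure of returns) + C`, and `C ≤ T / 2`.
  refine ⟨1 / (2 * S.card), by positivity, ?_⟩
  filter_upwards [eventually_ge_atTop (2 * C)] with T hT
  have hT0 : 0 ≤ T := by linarith
  -- If `w t` is near the net point `y = w (τ y)`, the isometry makes `t - τ y` a return time to `w
  -- 0`, possibly just outside `[0, T]`.
  have hcover : Icc 0 T ⊆ ⋃ y ∈ S, (fun t => t + -τ y) ⁻¹'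
      ((Icc 0 T ∩ P) ∪ (Icc (-|τ y|) 0 ∪ Icc T (T + |τ y|))) := by
    intro t ht
    have h1 := hS (mem_range_self t)
    simp only [mem_iUnion] at h1 ⊢
    obtain ⟨y, hy, hty⟩ := h1
    refine ⟨y, hy, ?_⟩
    have h2 : t + -τ y ∈ P := by
      have h3 := hiso (τ y) t (-τ y)
      rw [add_neg_cancel] at h3
      rw [hP, mem_ofPred_eq, h3, hwτ y hy, ← dist_eq_norm]
      exact le_of_lt hty
    simp only [mem_preimage, mem_union, mem_inter_iff, h2, and_true, mem_Icc]
    have h4 := le_abs_self (τ y)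
    have h5 := neg_abs_le (τ y)
    rcases lt_or_ge (t + -τ y) 0 with h6 | h6
    · exact Or.inr (Or.inl ⟨by linarith [ht.1], h6.le⟩)
    · rcases le_or_gt (t + -τ y) T with h7 | h7
      · exact Or.inl ⟨h6, h7⟩
      · exact Or.inr (Or.inr ⟨h7.le, by linarith [ht.2]⟩)
  have hm : ∀ y, volume.real ((fun t => t + -τ y) ⁻¹'
      ((Icc 0 T ∩ P) ∪ (Icc (-|τ y|) 0 ∪ Icc T (T + |τ y|)))) ≤
      volume.real (Icc 0 T ∩ P) + 2 * |τ y| := by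
    intro y
    rw [measureReal_def, measure_preimage_add_right, ← measureReal_def]
    refine (measureReal_union_le _ _).trans ?_
    gcongr
    refine (measureReal_union_le _ _).trans ?_
    simp only [Real.volume_real_Icc]
    simp [two_mul]
  have h1 : T ≤ S.card * volume.real (Icc 0 T ∩ P) + C := calc
    T = volume.real (Icc 0 T) := by simp [Real.volume_real_Icc, hT0]
    _ ≤ volume.real (⋃ y ∈ S, (fun t => t + -τ y) ⁻¹'
      ((Icc 0 T ∩ P) ∪ (Icc (-|τ y|) 0 ∪ Icc T (T + |τ y|)))) := by
      refine measureReal_mono hcover (measure_biUnion_lt_top S.finite_toSet fun y _ => ?_).ne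
      rw [measure_preimage_add_right]
      refine (measure_mono (t := Icc (-|τ y|) (T + |τ y|)) ?_).trans_lt (by simp)
      have := abs_nonneg (τ y)
      rintro t (h | h | h)
      · exact ⟨by linarith [h.1.1], by linarith [h.1.2]⟩
      · exact ⟨h.1, by linarith [h.2]⟩
      · exact ⟨by linarith [h.1], h.2⟩
    _ ≤ ∑ y ∈ S, (volume.real (Icc 0 T ∩ P) + 2 * |τ y|) :=
      (measureReal_biUnion_finset_le _ _).trans (Finset.sum_le_sum fun y _ => hm y)
    _ = _ := by rw [Finset.sum_add_distrib, Finset.sum_const, nsmul_eq_mul]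
  rw [one_div, inv_mul_le_iff₀ (by positivity)]
  linarith

/-- The mean of a function over `s` as a convex combination of means over `p ⊆ s` and `s \ p`. -/
theorem exists_setAverage_eq_combo [FiniteDimensional ℝ H] {C B : Set H} (hC : Convex ℝ C)
    (hCc : IsClosed C) (hB : Convex ℝ B) (hBc : IsClosed B) {w : ℝ → H} {s p : Set ℝ} (hps : p ⊆ s)
    (hs : MeasurableSet s) (hp : MeasurableSet p) (hp0 : volume p ≠ 0) (hsfin : volume s ≠ ⊤)
    (hw : IntegrableOn w s) (hwC : ∀ t ∈ s, w t ∈ C) (hwB : ∀ t ∈ p, w t ∈ B) :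
    ∃ b ∈ C ∩ B, ∃ k ∈ C, ⨍ t in s, w t =
      (volume.real p / volume.real s) • b + (1 - volume.real p / volume.real s) • k := by
  have hpfin : volume p ≠ ⊤ := ((measure_mono hps).trans_lt hsfin.lt_top).ne
  have hs0 : volume s ≠ 0 := fun h => hp0 (measure_mono_null hps h)
  have hsr : volume.real s ≠ 0 := by simp [measureReal_def, ENNReal.toReal_eq_zero_iff, hs0, hsfin]
  have hpr : volume.real p ≠ 0 := by simp [measureReal_def, ENNReal.toReal_eq_zero_iff, hp0, hpfin]
  have hb : ⨍ t in p, w t ∈ C ∩ B := (hC.inter hB).set_average_mem (hCc.inter hBc) hp0 hpfin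
    ((ae_restrict_iff' hp).2 (ae_of_all _ fun t ht => ⟨hwC t (hps ht), hwB t ht⟩)) (hw.mono_set hps)
  have hsum : ∫ t in s, w t = (∫ t in p, w t) + ∫ t in s \ p, w t := by
    rw [setIntegral_sdiff hp hw hps, add_sub_cancel]
  have hmeas : volume.real (s \ p) = volume.real s - volume.real p := measureReal_sdiff hps hp hsfin
  -- The average over a null set is 0 by default and need not lie in `C`. The weight of `k` is then
  -- 0, so `b` can serve as `k`.
  by_cases hd : volume (s \ p) = 0
  · have h1 : volume.real p = volume.real s := by
      have : volume.real (s \ p) = 0 := by simp [measureReal_def, hd]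
      linarith
    refine ⟨_, hb, _, hb.1, ?_⟩
    rw [setAverage_eq, setAverage_eq, hsum, Measure.restrict_eq_zero.2 hd, integral_zero_measure, h1,
      div_self hsr]
    simp
  · have hdfin : volume (s \ p) ≠ ⊤ := ((measure_mono sdiff_subset).trans_lt hsfin.lt_top).ne
    have hdr : volume.real s - volume.real p ≠ 0 := by
      rw [← hmeas]
      simp [measureReal_def, ENNReal.toReal_eq_zero_iff, hd, hdfin]
    have hk : ⨍ t in s \ p, w t ∈ C := hC.set_average_mem hCc hd hdfin
      ((ae_restrict_iff' (hs.diff hp)).2 (ae_of_all _ fun t ht => hwC t ht.1))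
      (hw.mono_set sdiff_subset)
    refine ⟨_, hb, _, hk, ?_⟩
    rw [setAverage_eq, setAverage_eq, setAverage_eq, hsum, smul_add, hmeas, smul_smul, smul_smul]
    congr 2
    · field_simp
    · field_simp

/-- A mean of a bounded solution with isometric translations is a saddle point, and the solution
contributes to it with positive weight at each of its points. -/
theorem IsSolution.exists_mean [FiniteDimensional ℝ H] (hKc : IsClosed K) (hK : Convex ℝ K)
    (hfc : ContinuousOn f K) (hf : IsDissipativeOn f K) (hw : IsSolution f K univ w)
    {R : ℝ} (hR : ∀ t, ‖w t‖ ≤ R) (hiso : ∀ s t c, ‖w (t + c) - w (s + c)‖ = ‖w t - w s‖) :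
    ∃ c ∈ saddles f K, ∀ δ > 0, ∃ b ∈ K, ‖b - w 0‖ ≤ δ ∧ ∃ k ∈ K, ∃ a ∈ Ioc (0 : ℝ) 1,
      c = a • b + (1 - a) • k := by
  set C := K ∩ Metric.closedBall 0 R with hC
  have hCcpt : IsCompact C := (isCompact_closedBall _ _).inter_left hKc
  have hCcvx : Convex ℝ C := hK.inter (convex_closedBall _ _)
  have hwC : ∀ t, w t ∈ C := fun t => ⟨hw.1 t trivial, by simpa using hR t⟩
  have hcont : Continuous w := by
    refine continuous_iff_continuousAt.2 fun t => ?_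
    exact (hw.2.1 (t - 1) (t + 1) (by linarith) (subset_univ _)).continuousOn.continuousAt (by
      rw [uIcc_of_le (by linarith)]
      exact Icc_mem_nhds (by linarith) (by linarith))
  have hint : ∀ T, IntegrableOn w (Icc 0 T) := fun T => hcont.continuousOn.integrableOn_Icc
  set m : ℝ → H := fun T => ⨍ t in Icc 0 T, w t with hm
  have hmC : ∀ T > 0, m T ∈ C := fun T hT =>
    hCcvx.set_average_mem hCcpt.isClosed (by simp [hT]) (by simp)
      (ae_of_all _ fun t => hwC t) (hint T)
  let U := Ultrafilter.of (atTop : Filter ℝ)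
  have hU : (U : Filter ℝ) ≤ atTop := Ultrafilter.of_le _
  obtain ⟨c, hcC, hc⟩ := isCompact_iff_ultrafilter_le_nhds.1 hCcpt (U.map m) (by
    rw [le_principal_iff, Ultrafilter.mem_coe, Ultrafilter.mem_map]
    exact hU (by filter_upwards [eventually_gt_atTop 0] with T hT using hmC T hT))
  have hc : Tendsto m U (𝓝 c) := hc
  refine ⟨c, ?_, fun δ hδ => ?_⟩
  · rw [saddles_eq hK hfc hf]
    refine ⟨hcC.1, fun u hu => ?_⟩
    -- `evi` on `[0, T]` divided by `2 * T`: the initial distance contributes a term of order `1 /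
    -- T`.
    have h1 : Tendsto (fun T : ℝ => inner ℝ (f u) (u - m T) - ‖w 0 - u‖ ^ 2 / 2 * T⁻¹) U
        (𝓝 (inner ℝ (f u) (u - c) - ‖w 0 - u‖ ^ 2 / 2 * 0)) :=
      (tendsto_const_nhds.inner (hc.const_sub u)).sub
        ((tendsto_inv_atTop_zero.mono_left hU).const_mul _)
    rw [mul_zero, sub_zero] at h1
    refine le_of_tendsto h1 (hU ?_)
    filter_upwards [eventually_gt_atTop 0] with T hT
    have h2 := hw.evi hf hu hT.le (subset_univ _)
    have h3 : ∫ r in (0 : ℝ)..T, 2 * inner ℝ (f u) (w r - u) =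
        2 * T * inner ℝ (f u) (m T - u) := by
      rw [intervalIntegral.integral_const_mul, intervalIntegral.integral_of_le hT.le,
        ← integral_Icc_eq_integral_Ioc, integral_inner]
      · rw [integral_sub (hint T) (integrable_const _), setIntegral_const]
        have : ∫ r in Icc 0 T, w r = T • m T := by
          rw [hm]
          simp only [setAverage_eq, Real.volume_real_Icc_of_le hT.le, sub_zero]
          rw [smul_smul, mul_inv_cancel₀ hT.ne', one_smul]
        rw [this, Real.volume_real_Icc_of_le hT.le, sub_zero, ← smul_sub, inner_smul_right]
        ring
      · exact (hint T).sub (integrable_const _)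
    rw [h3] at h2
    have h4 : inner ℝ (f u) (u - m T) = -inner ℝ (f u) (m T - u) := by
      rw [← inner_neg_right, neg_sub]
    rw [h4, ← div_eq_mul_inv, sub_nonpos, le_div_iff₀ hT]
    nlinarith [sq_nonneg ‖w T - u‖]
  · obtain ⟨a, ha, hev⟩ := exists_return_density
      (hCcpt.totallyBounded.subset (range_subset_iff.2 hwC)) hiso hδ
    set B := Metric.closedBall (w 0) δ with hB
    -- Weights bounded below by `a` make this set of combinations compact, so membership passes from
    -- the means to `c`.
    set G := (fun q : ℝ × H × H => q.1 • q.2.1 + (1 - q.1) • q.2.2) ''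
      (Icc a 1 ×ˢ (C ∩ B) ×ˢ C) with hG
    have hGc : IsClosed G := by
      refine (IsCompact.image ?_ (by fun_prop)).isClosed
      exact isCompact_Icc.prod ((hCcpt.inter_right Metric.isClosed_closedBall).prod hCcpt)
    have hcG : c ∈ G := by
      refine hGc.mem_of_tendsto hc (hU ?_)
      filter_upwards [hev, eventually_gt_atTop 0] with T h1 hT
      set p := Icc 0 T ∩ {t | ‖w t - w 0‖ ≤ δ} with hp
      have hpm : MeasurableSet p :=
        measurableSet_Icc.inter (isClosed_le (by fun_prop) continuous_const).measurableSet
      have hp0 : volume p ≠ 0 := by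
        intro h
        rw [measureReal_def, h] at h1
        simp only [ENNReal.toReal_zero] at h1
        nlinarith
      obtain ⟨b, hb, k, hk, h2⟩ := exists_setAverage_eq_combo (p := p) hCcvx hCcpt.isClosed
        (convex_closedBall (w 0) δ) Metric.isClosed_closedBall inter_subset_left measurableSet_Icc
        hpm hp0 (by simp) (hint T) (fun t _ => hwC t) (fun t ht => mem_closedBall_iff_norm.2 ht.2)
      have h3 : volume.real (Icc 0 T) = T := by rw [Real.volume_real_Icc_of_le hT.le, sub_zero]
      have h4 : volume.real p ≤ T :=
        h3 ▸ measureReal_mono inter_subset_left (by simp)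
      rw [h3] at h2
      exact ⟨(volume.real p / T, b, k), ⟨⟨(le_div_iff₀ hT).2 h1, (div_le_one hT).2 h4⟩, hb, hk⟩,
        h2.symm⟩
    obtain ⟨⟨l, b, k⟩, ⟨hl, hb, hk⟩, h⟩ := hcG
    exact ⟨b, hb.1.1, mem_closedBall_iff_norm.1 hb.2, k, hk.1, l, ⟨ha.trans_le hl.1, hl.2⟩, h.symm⟩

end Limits

/-! ### Directions of the face generated by a point. -/

section Faces

variable {H : Type*} [NormedAddCommGroup H] [InnerProductSpace ℝ H] {K : Set H} {c : H}

theorem eventually_mem_of_mem_intrinsicInterior {D : Set H} {d v : H}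
    (hd : d ∈ intrinsicInterior ℝ D) (hv : v ∈ vectorSpan ℝ D) : ∀ᶠ r in 𝓝 (0 : ℝ), d + r • v ∈ D := by
  obtain ⟨y, hy, rfl⟩ := mem_intrinsicInterior.1 hd
  have hmem : ∀ r : ℝ, (y : H) + r • v ∈ affineSpan ℝ D := fun r => by
    rw [add_comm, ← vadd_eq_add]
    refine AffineSubspace.vadd_mem_of_mem_direction ?_ y.2
    rw [direction_affineSpan]
    exact Submodule.smul_mem _ _ hv
  have hc : Continuous fun r : ℝ => (⟨(y : H) + r • v, hmem r⟩ : affineSpan ℝ D) := by fun_prop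
  have h0 : (⟨(y : H) + (0 : ℝ) • v, hmem 0⟩ : affineSpan ℝ D) = y := by ext; simp
  have h1 := hc.continuousAt (x := 0)
  rw [ContinuousAt, h0] at h1
  filter_upwards [h1 (isOpen_interior.mem_nhds hy)] with r hr
  exact interior_subset (s := ((↑) ⁻¹' D : Set (affineSpan ℝ D))) hr

/-- The directions in which `c` can be moved back and forth within the convex set `K`. -/
def faceDirection (hK : Convex ℝ K) (hc : c ∈ K) : Submodule ℝ H where
  carrier := {v | ∃ r > (0 : ℝ), c + r • v ∈ K ∧ c - r • v ∈ K}
  zero_mem' := ⟨1, one_pos, by simpa using hc, by simpa using hc⟩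
  add_mem' := by
    rintro v w ⟨r, hr, h1, h2⟩ ⟨s, hs, h3, h4⟩
    have hrs : 0 < r + s := add_pos hr hs
    -- With this step the point is the combination of `c ± r • v` and `c ± s • w` with weights `s /
    -- (r + s)` and `r / (r + s)`.
    refine ⟨r * s / (r + s), by positivity, ?_, ?_⟩
    · convert hK h1 h3 (a := s / (r + s)) (b := r / (r + s)) (by positivity) (by positivity)
        (by field_simp; ring) using 1
      match_scalars <;> field_simp
      ring
    · convert hK h2 h4 (a := s / (r + s)) (b := r / (r + s)) (by positivity) (by positivity)
        (by field_simp; ring) using 1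
      match_scalars <;> field_simp
      ring
  smul_mem' := by
    rintro a v ⟨r, hr, h1, h2⟩
    rcases lt_trichotomy a 0 with ha | rfl | ha
    · have ha' : 0 < -a := neg_pos.2 ha
      -- The negative sign interchanges the two endpoints.
      refine ⟨r / -a, by positivity, ?_, ?_⟩
      · have : (r / -a) • a • v = -(r • v) := by
          rw [smul_smul, ← neg_smul]; congr 1; field_simp [ha.ne]
        rwa [this, ← sub_eq_add_neg]
      · have : (r / -a) • a • v = -(r • v) := by
          rw [smul_smul, ← neg_smul]; congr 1; field_simp [ha.ne]
        rwa [this, sub_neg_eq_add]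
    · exact ⟨1, one_pos, by simpa using hc, by simpa using hc⟩
    · have : (r / a) • a • v = r • v := by
        rw [smul_smul]; congr 1; field_simp
      exact ⟨r / a, by positivity, by rwa [this], by rwa [this]⟩

theorem mem_faceDirection (hK : Convex ℝ K) (hc : c ∈ K) {v : H} :
    v ∈ faceDirection hK hc ↔ ∃ r > (0 : ℝ), c + r • v ∈ K ∧ c - r • v ∈ K := Iff.rfl

/-- Since `c` lies between `x` and `q`, one can move from `c` away from `x`, a fraction of the way
towards `q`. -/
theorem sub_mem_faceDirection_of_combo (hK : Convex ℝ K) (hc : c ∈ K) {x q : H} (hx : x ∈ K)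
    (hq : q ∈ K) {b : ℝ} (hb : 0 < b) (hb1 : b ≤ 1) (h : c = b • x + (1 - b) • q) :
    x - c ∈ faceDirection hK hc := by
  refine ⟨b, hb, lineMap_mem hK hc hx ⟨hb.le, hb1⟩, ?_⟩
  have : c - b • (x - c) = (1 - b) • q + b • c := by
    nth_rewrite 1 [h]
    module
  rw [this]
  exact hK hq hc (sub_nonneg.2 hb1) hb.le (by ring)

/-- The points that can be reached from `c` along directions of `faceDirection` are an extreme
subset of `K`. -/
theorem sub_mem_faceDirection_of_mem (hK : Convex ℝ K) (hc : c ∈ K) {x y : H} (hx : x ∈ K)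
    (hy : y ∈ K) {a : ℝ} (ha : 0 < a) (ha1 : a ≤ 1)
    (h : a • x + (1 - a) • y - c ∈ faceDirection hK hc) : x - c ∈ faceDirection hK hc := by
  obtain ⟨r, hr, -, h2⟩ := h
  -- `c` lies between `p` and `a • x + (1 - a) • y`. Expanded, `c` gives `x` the weight `r * a / (1
  -- + r)`; the rest, normalized, is the point `hq` of `K` on the segment from `p` to `y`.
  set p := c - r • (a • x + (1 - a) • y - c) with hp
  have hr1 : 0 < 1 + r := by linarith
  have hb : 0 < r * a / (1 + r) := by positivity
  have hb1 : r * a / (1 + r) < 1 := by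
    rw [div_lt_one hr1]
    nlinarith
  have hs : 0 < 1 + r * (1 - a) := by nlinarith
  have hq := hK h2 hy (a := 1 / (1 + r * (1 - a))) (b := r * (1 - a) / (1 + r * (1 - a)))
    (by positivity) (div_nonneg (mul_nonneg hr.le (sub_nonneg.2 ha1)) hs.le) (by field_simp)
  refine sub_mem_faceDirection_of_combo hK hc hx hq hb hb1.le ?_
  rw [hp]
  have h3 : 1 - r * a / (1 + r) = (1 + r * (1 - a)) / (1 + r) := by field_simp; ring
  rw [h3]
  match_scalars <;> field_simp <;> ring

end Faces

/-! ### The minimal face and its span. -/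

section MinimalFace

variable {n m : ℕ} {K : Set (E n m)} {c : E n m}

/-- The right-hand side is itself a face by `sub_mem_faceDirection_of_mem`. Conversely, `c` is
inside a segment of `K` that starts at `k`, so every face containing `c` contains `k`. -/
theorem minimalFace_eq (hK : Convex ℝ K) (hc : c ∈ K) {A : Set (E n m)} (hcA : c ∈ A) (hAK : A ⊆ K)
    (hA : ∀ a ∈ A, a - c ∈ faceDirection hK hc) :
    minimalFace K A = {k | k ∈ K ∧ k - c ∈ faceDirection hK hc} := by
  apply subset_antisymm
  · refine sInter_subset_of_mem ⟨⟨?_, fun k hk => hk.1, ?_⟩, fun a ha => ⟨hAK ha, hA a ha⟩⟩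
    · intro x hx y hy a b ha hb hab
      refine ⟨hK hx.1 hy.1 ha hb hab, ?_⟩
      have : a • x + b • y - c = a • (x - c) + b • (y - c) := by
        rw [smul_sub, smul_sub, sub_add_sub_comm, ← add_smul, hab, one_smul]
      rw [this]
      exact Submodule.add_mem _ (Submodule.smul_mem _ _ hx.2) (Submodule.smul_mem _ _ hy.2)
    · rintro x hx y hy z hz ⟨a, b, ha, hb, hab, rfl⟩
      obtain rfl : b = 1 - a := by linarith
      exact ⟨hx, sub_mem_faceDirection_of_mem hK hc hx hy ha (by linarith) hz.2⟩
  · rintro k ⟨hk, r, hr, -, h2⟩ F ⟨hF, hAF⟩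
    refine hF.2.left_mem_of_mem_openSegment hk h2 (hAF hcA) ?_
    have hr1 : 0 < 1 + r := by linarith
    refine ⟨r / (1 + r), 1 / (1 + r), by positivity, by positivity, by field_simp; ring, ?_⟩
    match_scalars <;> field_simp <;> ring

/-- As `c` is itself one of the directions, the affine span passes through 0 and equals its
direction. -/
theorem coe_affineSpan_face (hK : Convex ℝ K) (hc : c ∈ K) (h0 : (0 : E n m) ∈ K)
    (hc0 : c ∈ faceDirection hK hc) :
    (affineSpan ℝ {k | k ∈ K ∧ k - c ∈ faceDirection hK hc} : Set (E n m)) =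
      faceDirection hK hc := by
  have hmem : ∀ k, k - c ∈ faceDirection hK hc ↔ k ∈ faceDirection hK hc := fun k =>
    ⟨fun h => by simpa using Submodule.add_mem _ h hc0, fun h => Submodule.sub_mem _ h hc0⟩
  simp only [hmem]
  set F := {k | k ∈ K ∧ k ∈ faceDirection hK hc} with hF
  apply subset_antisymm
  · have : affineSpan ℝ F ≤ (faceDirection hK hc).toAffineSubspace :=
      affineSpan_le.2 fun k hk => hk.2
    exact this
  · intro v hv
    obtain ⟨r, hr, h1, -⟩ := (mem_faceDirection hK hc).1 hv
    have h2 : c ∈ affineSpan ℝ F := subset_affineSpan ℝ F ⟨hc, hc0⟩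
    have h3 : c + r • v ∈ affineSpan ℝ F :=
      subset_affineSpan ℝ F ⟨h1, Submodule.add_mem _ hc0 (Submodule.smul_mem _ _ hv)⟩
    have h4 : (0 : E n m) ∈ affineSpan ℝ F := subset_affineSpan ℝ F ⟨h0, Submodule.zero_mem _⟩
    have h5 := AffineSubspace.vsub_mem_direction h3 h2
    rw [vsub_eq_sub, add_sub_cancel_left] at h5
    have h6 := Submodule.smul_mem _ r⁻¹ h5
    rw [smul_smul, inv_mul_cancel₀ hr.ne', one_smul] at h6
    simpa using AffineSubspace.vadd_mem_of_mem_direction h6 h4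

theorem span_normalCone_submodule (W : Submodule ℝ (E n m)) :
    Submodule.span ℝ (normalCone (W : Set (E n m)) 0) = Wᗮ := by
  have : normalCone (W : Set (E n m)) 0 = (Wᗮ : Set (E n m)) := by
    ext v
    simp only [normalCone, mem_ofPred_eq, SetLike.mem_coe, sub_zero, Submodule.mem_orthogonal']
    refine ⟨fun h w hw => le_antisymm (h w hw) ?_, fun h w hw => (h w hw).le⟩
    simpa using h (-w) (Submodule.neg_mem _ hw)
  rw [this, Submodule.span_eq]

end MinimalFace

/-! ### From a non-convergent solution to a linear one in the face. -/

section Reduction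

variable {H : Type*} [NormedAddCommGroup H] [InnerProductSpace ℝ H] [FiniteDimensional ℝ H]
  {f : H → H} {K : Set H} {w : ℝ → H} {e : H}

/-- The difference of `w` and the primitive of `g` is absolutely continuous with derivative 0 almost
everywhere, hence locally constant; this upgrades an equation for almost every time to all times. -/
theorem hasDerivAt_of_ae_of_continuous {w g : ℝ → H}
    (hw : ∀ a b, a ≤ b → AbsolutelyContinuousOnInterval w a b) (hg : Continuous g)
    (h : ∀ᵐ t, HasDerivAt w (g t) t) (t : ℝ) : HasDerivAt w (g t) t := by
  have hG : ∀ t, HasDerivAt (fun t => ∫ r in (0 : ℝ)..t, g r) (g t) t := fun t =>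
    hg.integral_hasStrictDerivAt 0 t |>.hasDerivAt
  have hGd : ContDiff ℝ 1 (fun t => ∫ r in (0 : ℝ)..t, g r) := by
    refine contDiff_one_iff_deriv.2 ⟨fun t => (hG t).differentiableAt, ?_⟩
    convert hg using 1
    exact funext fun t => (hG t).deriv
  obtain ⟨C, hC⟩ := ((hw (t - 1) (t + 1) (by linarith)).fun_sub
    hGd.contDiffOn.absolutelyContinuousOnInterval).const_of_ae_hasDerivAt_zero (by
      filter_upwards [h] with r hr _
      exact ((hr.sub (hG r)).congr_deriv (sub_self _)))
  have h1 : HasDerivAt (fun r => C + ∫ s in (0 : ℝ)..r, g s) (g t) t := (hG t).const_add C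
  refine h1.congr_of_eventuallyEq ?_
  filter_upwards [Icc_mem_nhds (show t - 1 < t by linarith) (show t < t + 1 by linarith)] with r hr
  rw [← hC r (by rwa [uIcc_of_le (by linarith)]), sub_add_cancel]

/-- A solution that stays in the face of an equilibrium `e` and at a constant distance from `e`
solves the equation obtained by projecting `f` onto the directions of the face. -/
theorem IsSolution.hasDerivAt_proj (hfc : ContinuousOn f K) (hf : IsDissipativeOn f K)
    (hw : IsSolution f K univ w) (hK : Convex ℝ K) (he : e ∈ saddles f K)
    (hdist : ∀ t, ‖w t - e‖ = ‖w 0 - e‖) (hwe : ∀ t, w t ∈ faceDirection hK he.1) (t : ℝ) :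
    HasDerivAt w ((faceDirection hK he.1).starProjection (f (w t))) t := by
  set W := faceDirection hK he.1 with hW
  have hac : ∀ a b, a ≤ b → AbsolutelyContinuousOnInterval w a b := fun a b hab =>
    hw.2.1 a b hab (subset_univ _)
  have hcont : Continuous w := by
    refine continuous_iff_continuousAt.2 fun t => ?_
    exact (hac (t - 1) (t + 1) (by linarith)).continuousOn.continuousAt (by
      rw [uIcc_of_le (by linarith)]
      exact Icc_mem_nhds (by linarith) (by linarith))
  refine hasDerivAt_of_ae_of_continuous hac (g := fun t => W.starProjection (f (w t))) ?_ ?_ t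
  · exact W.starProjection.continuous.comp
      (hfc.comp_continuous hcont fun t => hw.1 t trivial)
  · have h1 := hw.2.2
    rw [Measure.restrict_univ] at h1
    filter_upwards [h1] with t ⟨d, hd, hp⟩
    have hwt := hw.1 t trivial
    have hdW : W.starProjection d = d := by
      have h2 := W.starProjection.hasFDerivAt.comp_hasDerivAt t hd
      refine h2.unique (hd.congr_of_eventuallyEq (Eventually.of_forall fun r => ?_))
      exact Submodule.starProjection_eq_self_iff.2 (hwe r)
    have h3 : inner ℝ (w t - e) d = 0 := by
      have h4 := (hd.sub_const e).norm_sq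
      have h5 : HasDerivAt (fun r => ‖w r - e‖ ^ 2) 0 t := by
        simp only [hdist]
        exact hasDerivAt_const _ _
      simpa using h4.unique h5
    -- The normal-cone inequality gives `≤`. Dissipativity and the saddle property of `e` give `⟨f
    -- w, w - e⟩ ≤ 0`, which with `h3` is `≥`.
    have h4 : inner ℝ (f (w t) - d) (e - w t) = 0 := by
      have h5 := hp e he.1
      have h6 := hf _ hwt _ he.1
      have h7 := he.2 _ hwt
      rw [real_inner_comm] at h3
      simp only [inner_sub_left, inner_sub_right] at *
      linarith
    -- By `h4` the normal vector is maximal on `K` at `e` too, and `e` can be moved both ways along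
    -- W.
    have h5 : f (w t) - d ∈ Wᗮ := by
      rw [Submodule.mem_orthogonal']
      rintro v ⟨r, hr, hv1, hv2⟩
      have h6 := hp _ hv1
      have h7 := hp _ hv2
      rw [add_sub_right_comm, inner_add_right, h4, zero_add, inner_smul_right] at h6
      rw [sub_right_comm, inner_sub_right, h4, zero_sub, inner_smul_right] at h7
      nlinarith
    have h6 := (Submodule.starProjection_apply_eq_zero_iff (K := W)).2 h5
    rw [map_sub, sub_eq_zero, hdW] at h6
    rwa [h6]

/-- `f`, projected onto the directions of the face of `e`, is linear along the segment from `0` to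
a point at which it is orthogonal to the saddle points `0` and `e`. -/
theorem proj_smul_eq (hf : IsDissipativeOn f K) (hK : Convex ℝ K)
    (he : e ∈ saddles f K) (h0 : (0 : H) ∈ saddles f K) {x : H}
    (hx : x ∈ K) (hx0 : inner ℝ (f x) x = 0) (hxe : inner ℝ (f x) e = 0)
    (hfc : ContinuousOn f K) {s : ℝ} (hs : s ∈ Ico (0 : ℝ) 1) :
    (faceDirection hK he.1).starProjection (f (s • x)) =
      s • (faceDirection hK he.1).starProjection (f x) := by
  set W := faceDirection hK he.1 with hW
  have h0K := h0.1
  have hsx : s • x ∈ K := by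
    simpa using lineMap_mem hK h0K hx ⟨hs.1, hs.2.le⟩
  have key : ∀ y ∈ K, inner ℝ (f (s • x) - s • f x) y ≤ 0 := by
    intro y hy
    -- The point is a combination of `x` and `(h / (1 - s)) • y`, which is where `s < 1` is needed.
    have hu : ∀ h ∈ Icc (0 : ℝ) (1 - s), s • x + h • y ∈ K := by
      intro h hh
      have h1 : s • x + h • y ∈ K := by
        have h2 : 0 < 1 - s := sub_pos.2 hs.2
        have h3 := hK h0K hy (a := 1 - h / (1 - s)) (b := h / (1 - s))
          (sub_nonneg.2 ((div_le_one h2).2 hh.2)) (div_nonneg hh.1 h2.le) (by ring)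
        convert hK hx h3 hs.1 h2.le (by ring) using 2
        rw [smul_zero, zero_add, smul_smul, mul_div_cancel₀ _ h2.ne']
      exact h1
    have hcont : ContinuousOn (fun h : ℝ => f (s • x + h • y)) (Icc 0 (1 - s)) :=
      hfc.comp (by fun_prop) hu
    have hcont2 : ContinuousOn (fun h : ℝ => inner ℝ (f (s • x + h • y) - s • f x) y)
        (Icc 0 (1 - s)) := (hcont.sub continuousOn_const).inner continuousOn_const
    have hlim := (hcont2 0 ⟨le_rfl, sub_nonneg.2 hs.2.le⟩).mono_left
      (nhdsWithin_mono 0 Ioc_subset_Icc_self)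
    have : (𝓝[Ioc (0 : ℝ) (1 - s)] 0).NeBot := by
      rw [nhdsWithin_Ioc_eq_nhdsGT (sub_pos.2 hs.2)]; infer_instance
    simp only [zero_smul, add_zero] at hlim
    refine le_of_tendsto hlim ?_
    filter_upwards [self_mem_nhdsWithin] with h hh
    have huK := hu h ⟨hh.1.le, hh.2⟩
    have h1 := hf _ huK _ hx
    have h2 := hf _ huK _ h0K
    have h3 := h0.2 _ huK
    -- Both terms on the right are nonpositive, by dissipativity against `x` and by the saddle point
    -- 0; `hx0` makes the identity hold.
    have h4 : h * inner ℝ (f (s • x + h • y) - s • f x) y =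
        s * inner ℝ (f (s • x + h • y) - f x) (s • x + h • y - x) +
        (1 - s) * inner ℝ (f (s • x + h • y)) (s • x + h • y) := by
      simp only [inner_sub_left, inner_sub_right, inner_add_right, inner_smul_right,
        real_inner_smul_left, hx0]
      ring
    rw [sub_zero] at h2 h3
    rw [inner_sub_left] at h2
    have h5 : inner ℝ (f (s • x + h • y)) (s • x + h • y) ≤ 0 := by linarith
    have h6 : h * inner ℝ (f (s • x + h • y) - s • f x) y ≤ 0 := by
      rw [h4]
      have := sub_pos.2 hs.2
      nlinarith [hs.1]
    exact nonpos_of_mul_nonpos_right h6 hh.1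
  -- Equality in `key` at `e`; testing `key` at `e ± r • v` then gives orthogonality to W.
  have hqe : inner ℝ (f (s • x) - s • f x) e = 0 := by
    refine le_antisymm (key e he.1) ?_
    have h1 := hf _ hsx _ he.1
    have h2 := he.2 _ hsx
    have h3 := hf _ hsx _ hx
    simp only [inner_sub_left, inner_sub_right, inner_smul_right, real_inner_smul_left, hx0,
      hxe] at h1 h2 h3 ⊢
    have h4 : 0 ≤ inner ℝ (f (s • x)) x := by nlinarith [hs.2]
    nlinarith [hs.1]
  have hq : f (s • x) - s • f x ∈ Wᗮ := by
    rw [Submodule.mem_orthogonal']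
    rintro v ⟨r, hr, h1, h2⟩
    have h3 := key _ h1
    have h4 := key _ h2
    rw [inner_add_right, hqe, zero_add, inner_smul_right] at h3
    rw [inner_sub_right, hqe, zero_sub, inner_smul_right] at h4
    nlinarith
  have h6 := (Submodule.starProjection_apply_eq_zero_iff (K := W)).2 hq
  rwa [map_sub, sub_eq_zero, map_smul] at h6

/-- If a bounded solution does not approach the set of saddle points, then some non-constant
solution on the whole time axis solves a linear equation in the directions of the minimal face. -/
theorem IsSolution.exists_linear_solution (hKc : IsClosed K) (hK : Convex ℝ K)
    (hfc : ContinuousOn f K) (hf : IsDissipativeOn f K) (h0 : (0 : H) ∈ saddles f K) {z : ℝ → H}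
    (hz : IsSolution f K (Ici 0) z) {ε : ℝ} (hε : 0 < ε)
    (hfreq : ∃ᶠ t in atTop, ∀ e ∈ saddles f K, ε ≤ dist (z t) e) :
    ∃ (e : H) (he : e ∈ saddles f K) (w : ℝ → H), IsSolution f K univ w ∧ (¬ ∃ c, ∀ t, w t = c) ∧
      (∀ x ∈ saddles f K, x - e ∈ faceDirection hK he.1) ∧
      (∀ t, w t ∈ faceDirection hK he.1) ∧
      (∀ t, HasDerivAt w ((faceDirection hK he.1).starProjection (f (w t))) t) ∧
      (∀ t, inner ℝ (f (w t)) (w t) = 0) ∧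
      ∀ t, ∀ s ∈ Ico (0 : ℝ) 1, (faceDirection hK he.1).starProjection (f (s • w t)) =
        s • (faceDirection hK he.1).starProjection (f (w t)) := by
  -- Late times at which `z` is far from the saddle points: the limit at time 0 is then no saddle
  -- point, so `w` cannot be constant.
  set l := atTop ⊓ 𝓟 {t | ∀ e ∈ saddles f K, ε ≤ dist (z t) e} with hl
  have : l.NeBot := frequently_mem_iff_neBot.1 hfreq
  obtain ⟨U, hU, w, hzw, hw⟩ := hz.exists_limit hKc hK hfc hf h0 l inf_le_left
  have hUt : (U : Filter ℝ) ≤ atTop := hU.trans inf_le_left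
  have hdist : ∀ e ∈ saddles f K, ∀ t, ‖w t - e‖ = ‖w 0 - e‖ := fun e he t =>
    hz.norm_sub_const hf hUt hzw he t
  have hR : ∀ t, ‖w t‖ ≤ ‖w 0‖ := fun t => by simpa using (hdist 0 h0 t).le
  -- From a relative interior point every saddle point can be approached and receded from, so the
  -- face of `e` contains them all.
  obtain ⟨e, he'⟩ := Set.Nonempty.intrinsicInterior (convex_saddles hK hfc hf) ⟨0, h0⟩
  have he : e ∈ saddles f K := intrinsicInterior_subset he'
  have hface : ∀ x ∈ saddles f K, x - e ∈ faceDirection hK he.1 := by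
    intro x hx
    have h1 := eventually_mem_of_mem_intrinsicInterior he' (vsub_mem_vectorSpan ℝ hx he)
    have h2 : Tendsto (fun r : ℝ => -r) (𝓝 0) (𝓝 0) := by
      simpa using (continuous_neg (G := ℝ)).tendsto 0
    obtain ⟨r, h3, hr⟩ := (((h1.and (h2.eventually h1)).filter_mono
      (nhdsWithin_le_nhds (s := Ioi (0 : ℝ)))).and self_mem_nhdsWithin).exists
    simp only [vsub_eq_sub, neg_smul, ← sub_eq_add_neg] at h3
    exact ⟨r, hr, h3.1.1, h3.2.1⟩
  have he0 : e ∈ faceDirection hK he.1 := by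
    simpa using Submodule.neg_mem _ (hface 0 h0)
  have hw0 : ∀ t, w t ∈ faceDirection hK he.1 := by
    intro t
    have hwt : IsSolution f K univ (fun r => w (r + t)) :=
      hw.comp_add_const MeasurableSet.univ MeasurableSet.univ fun _ _ => trivial
    obtain ⟨c, hc, h⟩ := hwt.exists_mean hKc hK hfc hf (fun r => hR (r + t)) fun r s a => by
      rw [add_right_comm r, add_right_comm s]
      exact hz.norm_sub_shift hf hUt hzw _ _ _
    simp only [zero_add] at h
    -- Only points `b` near `w t` are known to lie in the subspace; it is closed.
    have hcl := (faceDirection hK he.1).closed_of_finiteDimensional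
    refine hcl.closure_subset (Metric.mem_closure_iff.2 fun δ hδ => ?_)
    obtain ⟨b, hb, hbt, k, hk, a, ha, rfl⟩ := h (δ / 2) (half_pos hδ)
    have h1 := sub_mem_faceDirection_of_mem hK he.1 hb hk ha.1 ha.2 (hface _ hc)
    refine ⟨b, by simpa using Submodule.add_mem _ h1 he0, ?_⟩
    rw [dist_comm, dist_eq_norm]
    linarith
  have hder := hw.hasDerivAt_proj hfc hf hK he (hdist e he) hw0
  have horth : ∀ x ∈ saddles f K, ∀ t, inner ℝ (f (w t)) (w t - x) = 0 := by
    intro x hx t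
    have h1 := ((hder t).sub_const x).norm_sq
    have h2 : HasDerivAt (fun r => ‖w r - x‖ ^ 2) 0 t := by
      simp only [hdist x hx]
      exact hasDerivAt_const _ _
    have h3 := h1.unique h2
    have hx0 : w t - x ∈ faceDirection hK he.1 :=
      Submodule.sub_mem _ (hw0 t) (by simpa using Submodule.add_mem _ (hface x hx) he0)
    rw [← Submodule.inner_starProjection_left_eq_right,
      Submodule.starProjection_eq_self_iff.2 hx0, real_inner_comm] at h3
    linarith
  have hww : ∀ t, inner ℝ (f (w t)) (w t) = 0 := fun t => by simpa using horth 0 h0 t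
  refine ⟨e, he, w, hw, ?_, hface, hw0, hder, hww, fun t s hs => ?_⟩
  · rintro ⟨c, hc⟩
    have hcs : c ∈ saddles f K := by
      have h1 := hw.2.2
      rw [Measure.restrict_univ] at h1
      obtain ⟨t, d, hd, h2⟩ := h1.exists
      have h3 : d = 0 := hd.unique ((hasDerivAt_const t c).congr_of_eventuallyEq
        (Eventually.of_forall hc))
      rw [h3, sub_zero, hc] at h2
      exact ⟨hc t ▸ hw.1 t trivial, h2⟩
    have h1 := (hzw 0).dist (tendsto_const_nhds (x := c))
    rw [hc, dist_self] at h1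
    have h2 : ∀ᶠ r in (U : Filter ℝ), ε ≤ dist (z (r + 0)) c := hU (mem_inf_of_right (by
      intro r hr
      simpa using hr c hcs))
    exact absurd (ge_of_tendsto h1 h2) (not_le.2 hε)
  · refine proj_smul_eq hf hK he h0 (hw.1 t trivial) (hww t) ?_ hfc hs
    have := horth e he t
    rwa [inner_sub_right, hww, zero_sub, neg_eq_zero] at this

end Reduction

/-! ### Derivative of the field; dissipativity from concave-convexity. -/

section Calculus

variable {n m : ℕ} {φ : E n m → ℝ} {z : E n m}

theorem pt_xPart_add_pt_yPart (v : E n m) : pt (xPart v) 0 + pt 0 (yPart v) = v := by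
  ext k; cases k <;> simp [pt, xPart, yPart]

theorem pt_xPart_eq_sum (v : E n m) :
    (pt (xPart v) 0 : E n m) = ∑ i, v (Sum.inl i) • EuclideanSpace.single (Sum.inl i) (1 : ℝ) := by
  ext k
  cases k <;> simp [pt, xPart, Finset.sum_apply, Pi.single_apply]

theorem pt_yPart_eq_sum (v : E n m) :
    (pt 0 (yPart v) : E n m) = ∑ j, v (Sum.inr j) • EuclideanSpace.single (Sum.inr j) (1 : ℝ) := by
  ext k
  cases k <;> simp [pt, yPart, Finset.sum_apply, Pi.single_apply]

theorem differentiableAt_fderiv (h : ContDiffAt ℝ 2 φ z) : DifferentiableAt ℝ (fderiv ℝ φ) z :=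
  (h.fderiv_right (m := 1) (by norm_num)).differentiableAt one_ne_zero

theorem hess_eq (h : ContDiffAt ℝ 2 φ z) (k l : Fin n ⊕ Fin m) :
    hess φ z k l = fderiv ℝ (fderiv ℝ φ) z (EuclideanSpace.single k 1)
      (EuclideanSpace.single l 1) := by
  have h1 : HasFDerivAt (fun x => fderiv ℝ φ x (EuclideanSpace.single l 1))
      ((fderiv ℝ (fderiv ℝ φ) z).flip (EuclideanSpace.single l 1)) z := by
    simpa using (differentiableAt_fderiv h).hasFDerivAt.clm_apply (hasFDerivAt_const _ _)
  simp only [hess, Matrix.of_apply]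
  unfold pderiv
  rw [h1.fderiv, ContinuousLinearMap.flip_apply]

theorem fderiv_fderiv_symm (h : ContDiffAt ℝ 2 φ z) (v u : E n m) :
    fderiv ℝ (fderiv ℝ φ) z v u = fderiv ℝ (fderiv ℝ φ) z u v :=
  h.isSymmSndFDerivAt (by simp) v u

theorem inner_matB (h : ContDiffAt ℝ 2 φ z) (v u : E n m) :
    inner ℝ (Matrix.toEuclideanLin (matB φ z) v) u =
      fderiv ℝ (fderiv ℝ φ) z (pt (xPart u) 0) (pt (xPart v) 0) -
      fderiv ℝ (fderiv ℝ φ) z (pt 0 (yPart u)) (pt 0 (yPart v)) := by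
  simp only [pt_xPart_eq_sum, pt_yPart_eq_sum, map_sum, sum_apply, map_smul,
    smul_apply, ← hess_eq h]
  simp [PiLp.inner_apply, Fintype.sum_sum_type, matB, Matrix.toEuclideanLin, Matrix.mulVec,
    dotProduct, Matrix.toBlocks₁₁, Matrix.toBlocks₂₂, Finset.mul_sum, sub_eq_add_neg]
  congr 1
  · rw [Finset.sum_comm]
    exact Finset.sum_congr rfl fun i _ => Finset.sum_congr rfl fun j _ => by ring
  · rw [Finset.sum_comm]
    exact congrArg Neg.neg
      (Finset.sum_congr rfl fun i _ => Finset.sum_congr rfl fun j _ => by ring)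

theorem inner_matA (h : ContDiffAt ℝ 2 φ z) (v u : E n m) :
    inner ℝ (Matrix.toEuclideanLin (matA φ z) v) u =
      fderiv ℝ (fderiv ℝ φ) z (pt (xPart u) 0) (pt 0 (yPart v)) -
      fderiv ℝ (fderiv ℝ φ) z (pt 0 (yPart u)) (pt (xPart v) 0) := by
  simp only [pt_xPart_eq_sum, pt_yPart_eq_sum, map_sum, sum_apply, map_smul,
    smul_apply, ← hess_eq h]
  simp [PiLp.inner_apply, Fintype.sum_sum_type, matA, Matrix.toEuclideanLin, Matrix.mulVec,
    dotProduct, Matrix.toBlocks₁₂, Matrix.toBlocks₂₁, Finset.mul_sum, sub_eq_add_neg]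
  congr 1
  · rw [Finset.sum_comm]
    exact Finset.sum_congr rfl fun i _ => Finset.sum_congr rfl fun j _ => by ring
  · rw [Finset.sum_comm]
    exact congrArg Neg.neg
      (Finset.sum_congr rfl fun i _ => Finset.sum_congr rfl fun j _ => by ring)

theorem inner_matA_self (h : ContDiffAt ℝ 2 φ z) (v : E n m) :
    inner ℝ (Matrix.toEuclideanLin (matA φ z) v) v = 0 := by
  rw [inner_matA h, fderiv_fderiv_symm h, sub_self]

theorem inner_matB_comm (h : ContDiffAt ℝ 2 φ z) (v u : E n m) :
    inner ℝ (Matrix.toEuclideanLin (matB φ z) v) u =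
      inner ℝ (Matrix.toEuclideanLin (matB φ z) u) v := by
  rw [inner_matB h, inner_matB h, fderiv_fderiv_symm h, fderiv_fderiv_symm h (pt 0 (yPart u))]

theorem hasFDerivAt_field (h : ContDiffAt ℝ 2 φ z) :
    HasFDerivAt (field φ) (LinearMap.toContinuousLinearMap
      (Matrix.toEuclideanLin (matA φ z) + Matrix.toEuclideanLin (matB φ z))) z := by
  rw [← hasFDerivWithinAt_univ, hasFDerivWithinAt_euclidean]
  intro k
  rw [hasFDerivWithinAt_univ]
  set e : E n m := EuclideanSpace.single k 1 with he
  have hk : ∀ v : E n m, v k = inner ℝ v e := fun v => by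
    rw [he, EuclideanSpace.inner_single_right]
    simp
  have h1 : ∀ u : E n m, HasFDerivAt (fun x => fderiv ℝ φ x u)
      ((fderiv ℝ (fderiv ℝ φ) z).flip u) z := fun u => by
    simpa using (differentiableAt_fderiv h).hasFDerivAt.clm_apply (hasFDerivAt_const u _)
  have h2 := (h1 (pt (xPart e) 0)).sub (h1 (pt 0 (yPart e)))
  have h3 : (fun x => field φ x k) =
      (fun x => fderiv ℝ φ x (pt (xPart e) 0)) - fun x => fderiv ℝ φ x (pt 0 (yPart e)) := by
    funext x
    rw [hk, inner_field]
    rfl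
  rw [h3]
  refine h2.congr_fderiv (ContinuousLinearMap.ext fun v => Eq.symm ?_)
  change (Matrix.toEuclideanLin (matA φ z) v + Matrix.toEuclideanLin (matB φ z) v) k =
    fderiv ℝ (fderiv ℝ φ) z v (pt (xPart e) 0) - fderiv ℝ (fderiv ℝ φ) z v (pt 0 (yPart e))
  rw [hk, inner_add_left, inner_matA h, inner_matB h, fderiv_fderiv_symm h v,
    fderiv_fderiv_symm h v]
  conv_rhs => rw [← pt_xPart_add_pt_yPart v, map_add, map_add]
  ring

theorem hasDerivAt_fderiv_line {F : Type*} [NormedAddCommGroup F] [NormedSpace ℝ F] {ψ : F → ℝ}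
    {z : F} (h : DifferentiableAt ℝ (fderiv ℝ ψ) z) (u a : F) :
    HasDerivAt (fun r : ℝ => fderiv ℝ ψ (z + r • u) a) (fderiv ℝ (fderiv ℝ ψ) z u a) 0 := by
  have h1 : HasDerivAt (fun r : ℝ => z + r • u) u 0 := by
    simpa using ((hasDerivAt_id (0 : ℝ)).smul_const u).const_add z
  have h2 : HasFDerivAt (fun x => fderiv ℝ ψ x a) ((fderiv ℝ (fderiv ℝ ψ) z).flip a)
      (z + (0 : ℝ) • u) := by
    rw [zero_smul, add_zero]
    simpa using h.hasFDerivAt.clm_apply (hasFDerivAt_const a z)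
  exact h2.comp_hasDerivAt 0 h1

theorem eventually_differentiableAt_line {F : Type*} [NormedAddCommGroup F] [NormedSpace ℝ F]
    {ψ : F → ℝ} {z : F} (h : ContDiffAt ℝ 2 ψ z) (u : F) :
    ∀ᶠ r in 𝓝 (0 : ℝ), DifferentiableAt ℝ ψ (z + r • u) := by
  have h1 : ∀ᶠ x in 𝓝 z, DifferentiableAt ℝ ψ x := by
    filter_upwards [h.eventually (by simp)] with x hx using hx.differentiableAt two_ne_zero
  have h2 : Continuous fun r : ℝ => z + r • u := by fun_prop
  exact (h2.tendsto' 0 z (by simp)).eventually h1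

/-- A function that is convex on all segments of `D` in the direction `a` has a nonnegative second
derivative in that direction, at boundary points of `D` as well. -/
theorem fderiv_fderiv_nonneg {ψ : E n m → ℝ} {D : Set (E n m)} (hD : Convex ℝ D) (hz : z ∈ D)
    (h : ContDiffAt ℝ 2 ψ z) {a : E n m} (ha : a ∈ vectorSpan ℝ D)
    (hc : ∀ p ∈ D, ∀ r : ℝ, p + r • a ∈ D → ConvexOn ℝ (segment ℝ p (p + r • a)) ψ) :
    0 ≤ fderiv ℝ (fderiv ℝ ψ) z a a := by
  -- A segment from `d` to `d + s • a` in `D`, contracted towards `z` by the factor `r`, stays in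
  -- `D` and shrinks to `z`. Monotonicity of the directional derivative along it, divided by `r`,
  -- gives the sign at `z`.
  obtain ⟨d, hd⟩ := Set.Nonempty.intrinsicInterior hD ⟨z, hz⟩
  obtain ⟨s, hs, hs0⟩ := (((eventually_mem_of_mem_intrinsicInterior hd ha).filter_mono
    (nhdsWithin_le_nhds (s := Ioi (0 : ℝ)))).and self_mem_nhdsWithin).exists
  have hs0 : 0 < s := hs0
  have hdD : d ∈ D := intrinsicInterior_subset hd
  have hder2 := fun u => hasDerivAt_fderiv_line (differentiableAt_fderiv h) u a
  have hdiff := eventually_differentiableAt_line h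
  have hg := (hder2 (d + s • a - z)).sub (hder2 (d - z))
  have hval : fderiv ℝ (fderiv ℝ ψ) z (d + s • a - z) a - fderiv ℝ (fderiv ℝ ψ) z (d - z) a =
      s * fderiv ℝ (fderiv ℝ ψ) z a a := by
    rw [← sub_apply, ← map_sub]
    have : d + s • a - z - (d - z) = s • a := by abel
    rw [this, map_smul]
    rfl
  rw [hval] at hg
  have h5 : 0 ≤ s * fderiv ℝ (fderiv ℝ ψ) z a a := by
    refine ge_of_tendsto (hg.tendsto_slope.mono_left (nhdsGT_le_nhdsNE 0)) ?_
    filter_upwards [self_mem_nhdsWithin, nhdsWithin_le_nhds (hdiff (d + s • a - z)),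
      nhdsWithin_le_nhds (hdiff (d - z)),
      nhdsWithin_le_nhds (eventually_le_nhds one_pos)] with r hr hq hp hr1
    have hr : 0 < r := hr
    rw [slope_def_field]
    refine div_nonneg ?_ (by simpa using hr.le)
    simp only [Pi.sub_apply, zero_smul, add_zero, sub_self, sub_zero, sub_nonneg]
    have hpD := lineMap_mem hD hz hdD ⟨hr.le, hr1⟩
    have hqD := lineMap_mem hD hz hs ⟨hr.le, hr1⟩
    have hpq : z + r • (d + s • a - z) = z + r • (d - z) + (r * s) • a := by module
    rw [hpq] at hqD hq ⊢
    set p := z + r • (d - z) with hp'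
    have hcv := hc p hpD _ hqD
    have h6 := fderiv_le_sub hp hcv
    have h7 := fderiv_le_sub hq (segment_symm ℝ p _ ▸ hcv)
    rw [add_sub_cancel_left, map_smul, smul_eq_mul] at h6
    rw [sub_add_cancel_left, map_neg, map_smul, smul_eq_mul] at h7
    have h8 : 0 < r * s := mul_pos hr hs0
    by_contra! h9
    nlinarith
  exact nonneg_of_mul_nonneg_right h5 hs0

theorem SlicewiseConcaveConvex.convexOn_y {D : Set (E n m)} (h : SlicewiseConcaveConvex φ D)
    (hD : Convex ℝ D) {p q : E n m} (hp : p ∈ D) (hq : q ∈ D) (hpq : xPart p = xPart q) :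
    ConvexOn ℝ (segment ℝ p q) φ := by
  have hx : ∀ u ∈ segment ℝ p q, xPart u = xPart p := by
    rintro u ⟨a, b, ha, hb, hab, rfl⟩
    have : xPart (a • p + b • q) = a • xPart p + b • xPart q := rfl
    rw [this, ← hpq, ← add_smul, hab, one_smul]
  refine ⟨convex_segment _ _, fun u hu v hv a b ha hb hab => ?_⟩
  have huD := hD.segment_subset hp hq hu
  have hvD := hD.segment_subset hp hq hv
  rw [← pt_parts u, hx u hu] at huD ⊢
  rw [← pt_parts v, hx v hv] at hvD ⊢
  have := (h.2 (xPart p)).2 huD hvD ha hb hab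
  rwa [pt_combo, ← add_smul, hab, one_smul]

theorem SlicewiseConcaveConvex.convexOn_neg_x {D : Set (E n m)} (h : SlicewiseConcaveConvex φ D)
    (hD : Convex ℝ D) {p q : E n m} (hp : p ∈ D) (hq : q ∈ D) (hpq : yPart p = yPart q) :
    ConvexOn ℝ (segment ℝ p q) (-φ) := by
  have hx : ∀ u ∈ segment ℝ p q, yPart u = yPart p := by
    rintro u ⟨a, b, ha, hb, hab, rfl⟩
    have : yPart (a • p + b • q) = a • yPart p + b • yPart q := rfl
    rw [this, ← hpq, ← add_smul, hab, one_smul]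
  refine ⟨convex_segment _ _, fun u hu v hv a b ha hb hab => ?_⟩
  have huD := hD.segment_subset hp hq hu
  have hvD := hD.segment_subset hp hq hv
  rw [← pt_parts u, hx u hu] at huD ⊢
  rw [← pt_parts v, hx v hv] at hvD ⊢
  have := (h.1 (yPart p)).neg.2 huD hvD ha hb hab
  rw [pt_combo, ← add_smul, hab, one_smul]
  exact this

/-- B decouples the two parts of `v`, and `hprod` keeps each part among the directions of `D`, so
slicewise concavity and convexity apply separately. -/
theorem inner_matB_self_nonpos {D : Set (E n m)} (hD : Convex ℝ D)
    (hprod : ∀ v ∈ vectorSpan ℝ D, pt (xPart v) 0 ∈ vectorSpan ℝ D)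
    (hcc : SlicewiseConcaveConvex φ D) (hz : z ∈ D) (h : ContDiffAt ℝ 2 φ z) {v : E n m}
    (hv : v ∈ vectorSpan ℝ D) : inner ℝ (Matrix.toEuclideanLin (matB φ z) v) v ≤ 0 := by
  have hy : pt 0 (yPart v) ∈ vectorSpan ℝ D := by
    have := Submodule.sub_mem _ hv (hprod v hv)
    rwa [← eq_sub_of_add_eq' (pt_xPart_add_pt_yPart v)] at this
  have h1 := fderiv_fderiv_nonneg hD hz h hy fun p hp r hq => hcc.convexOn_y hD hp hq (by
    ext i; simp [xPart, pt])
  have h2 := fderiv_fderiv_nonneg (ψ := -φ) hD hz h.neg (hprod v hv) fun p hp r hq =>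
    hcc.convexOn_neg_x hD hp hq (by ext i; simp [yPart, pt])
  have h3 : fderiv ℝ (-φ) = -fderiv ℝ φ := funext fun x => fderiv_neg
  rw [h3, fderiv_neg] at h2
  simp only [neg_apply] at h2
  rw [inner_matB h]
  linarith

/-- Along a segment the derivative of the field, paired with the direction, is the quadratic form of
`A + B`; A is skew and B contributes a nonpositive amount. -/
theorem isDissipativeOn_field {K : Set (E n m)} (hK : Convex ℝ K)
    (hφ : ∀ z ∈ K, ContDiffAt ℝ 2 φ z) (hcc : ConcaveConvexOn φ K) :
    IsDissipativeOn (field φ) K := by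
  obtain ⟨D, hD, hKD, hprod, hs⟩ := hcc
  intro u hu v hv
  have hmem : ∀ s ∈ Icc (0 : ℝ) 1, v + s • (u - v) ∈ K := fun s hs => lineMap_mem hK hv hu hs
  have hder : ∀ s ∈ Icc (0 : ℝ) 1, HasDerivAt
      (fun s : ℝ => inner ℝ (field φ (v + s • (u - v))) (u - v))
      (inner ℝ (Matrix.toEuclideanLin (matB φ (v + s • (u - v))) (u - v)) (u - v)) s := by
    intro s hs
    have h1 : HasDerivAt (fun s : ℝ => v + s • (u - v)) (u - v) s := by
      simpa using ((hasDerivAt_id s).smul_const (u - v)).const_add v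
    have h2 := ((hasFDerivAt_field (hφ _ (hmem s hs))).comp_hasDerivAt s h1).inner ℝ
      (hasDerivAt_const s (u - v))
    refine h2.congr_deriv ?_
    have h3 := inner_matA_self (hφ _ (hmem s hs)) (u - v)
    rw [inner_zero_right, zero_add]
    change inner ℝ (Matrix.toEuclideanLin (matA φ (v + s • (u - v))) (u - v) +
      Matrix.toEuclideanLin (matB φ (v + s • (u - v))) (u - v)) (u - v) = _
    rw [inner_add_left, h3, zero_add]
  have hanti : AntitoneOn (fun s : ℝ => inner ℝ (field φ (v + s • (u - v))) (u - v)) (Icc 0 1) := by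
    refine antitoneOn_of_hasDerivWithinAt_nonpos (convex_Icc 0 1)
      (fun s hs => (hder s hs).continuousAt.continuousWithinAt)
      (fun s hs => (hder s (interior_subset hs)).hasDerivWithinAt) fun s hs' => ?_
    have hs' := interior_subset hs'
    exact inner_matB_self_nonpos hD hprod hs (hKD (hmem s hs')) (hφ _ (hmem s hs'))
      (vsub_mem_vectorSpan ℝ (hKD hu) (hKD hv))
  have := hanti (left_mem_Icc.2 zero_le_one) (right_mem_Icc.2 zero_le_one) zero_le_one
  simp only [one_smul, zero_smul, add_zero, add_sub_cancel] at this
  rw [inner_sub_left]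
  linarith

end Calculus

/-! ### Trajectories versus solutions, and the matrix identities. -/

section Trajectories

variable {n m : ℕ} {φ : E n m → ℝ} {K : Set (E n m)} {z : ℝ → E n m}

theorem IsTrajectory.isSolution {I : Set ℝ} (hz : IsTrajectory φ K I z) :
    IsSolution (field φ) K I z := by
  refine ⟨hz.1, hz.2.1, hz.2.2.mono ?_⟩
  rintro t ⟨p, hp, hd⟩
  refine ⟨_, hd, fun u hu => ?_⟩
  rw [sub_sub_cancel]
  exact hp.1 u hu

/-- The velocity `d` is orthogonal to all normal vectors, so `⟨f - q, d⟩ = ‖d‖ ^ 2` for each normal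
`q`, and Cauchy–Schwarz makes `f - d` the nearest one. -/
theorem IsSolution.isTrajectory (hz : IsSolution (field φ) K univ z) :
    IsTrajectory φ K univ z := by
  refine ⟨hz.1, hz.2.1, hz.2.2.mono ?_⟩
  rintro t ⟨d, hd, hp⟩
  have horth : ∀ q ∈ normalCone K (z t), inner ℝ q d = 0 := fun q hq =>
    inner_deriv_eq_zero hd (Eventually.of_forall fun r => hz.1 r trivial) hq
  refine ⟨field φ (z t) - d, ⟨hp, fun q hq => ?_⟩, by rwa [sub_sub_cancel]⟩
  rw [dist_eq_norm, dist_eq_norm, sub_sub_cancel]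
  have h1 := horth _ hp
  have h2 := horth _ hq
  have h3 : inner ℝ (field φ (z t) - q) d = ‖d‖ ^ 2 := by
    rw [inner_sub_left, real_inner_self_eq_norm_sq] at h1
    rw [inner_sub_left]
    linarith
  have h4 := real_inner_le_norm (field φ (z t) - q) d
  by_contra! h5
  nlinarith [norm_nonneg (field φ (z t) - q)]

theorem isEquilibrium_of_mem_saddles {e : E n m} (he : e ∈ saddles (field φ) K) :
    IsEquilibrium φ K e := by
  have h := isSolution_const (I := Ici 0) he
  refine ⟨h.1, h.2.1, ae_of_all _ fun t => ⟨field φ e, ⟨he.2, fun q _ => ?_⟩, ?_⟩⟩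
  · rw [dist_self]
    exact dist_nonneg
  · rw [sub_self]
    exact hasDerivAt_const _ _

theorem proj_eq_starProjection (hK : Convex ℝ K) {e : E n m} (he : e ∈ saddles (field φ) K)
    (h0 : (0 : E n m) ∈ saddles (field φ) K)
    (hface : ∀ x ∈ saddles (field φ) K, x - e ∈ faceDirection hK he.1) :
    proj φ K = (faceDirection hK he.1).starProjection := by
  have he0 : e ∈ faceDirection hK he.1 := by
    simpa using Submodule.neg_mem _ (hface 0 h0)
  have h1 : (faceSpan φ K : Set (E n m)) = faceDirection hK he.1 := by
    rw [faceSpan, minimalFace_eq hK he.1 (A := {z | IsRestrictedSaddle φ K z}) he (fun x hx => hx.1)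
      hface, coe_affineSpan_face hK he.1 h0.1 he0]
  have h2 : (Submodule.span ℝ (normalCone (faceSpan φ K : Set (E n m)) 0))ᗮ =
      faceDirection hK he.1 := by
    rw [h1, span_normalCone_submodule, Submodule.orthogonal_orthogonal]
  unfold proj
  simp only [h2]

/-- If the projected field is linear along `[0, x]` and orthogonal to `x`, then the symmetric part
of its derivative annihilates `x`, and the skew part maps `x` to the value of the field. -/
theorem compress_eq_of_linear {D : Set (E n m)} (hD : Convex ℝ D) (hKD : K ⊆ D)
    (hprod : ∀ v ∈ vectorSpan ℝ D, pt (xPart v) 0 ∈ vectorSpan ℝ D)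
    (hcc : SlicewiseConcaveConvex φ D) (hK : Convex ℝ K) (h0 : (0 : E n m) ∈ K)
    (hφ : ∀ z ∈ K, ContDiffAt ℝ 2 φ z) {W : Submodule ℝ (E n m)}
    (hWD : ∀ v ∈ W, v ∈ vectorSpan ℝ D) (hproj : proj φ K = W.starProjection) {x : E n m}
    (hx : x ∈ K) (hxW : x ∈ W) (hx0 : inner ℝ (field φ x) x = 0)
    (hlin : ∀ s ∈ Ico (0 : ℝ) 1, W.starProjection (field φ (s • x)) =
      s • W.starProjection (field φ x)) {r : ℝ} (hr : r ∈ Icc (0 : ℝ) 1) :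
    compress φ K (matB φ (r • x)) x = 0 ∧
      compress φ K (matA φ (r • x)) x = W.starProjection (field φ x) := by
  have hrx : r • x ∈ K := by simpa using lineMap_mem hK h0 hx hr
  have hC := hφ _ hrx
  have hcomp : ∀ M, compress φ K M x = W.starProjection (Matrix.toEuclideanLin M x) := fun M => by
    simp only [compress, hproj, LinearMap.comp_apply, ContinuousLinearMap.coe_coe,
      Submodule.starProjection_eq_self_iff.2 hxW]
  have hlin' : ∀ s ∈ Icc (0 : ℝ) 1, W.starProjection (field φ (s • x)) =
      s • W.starProjection (field φ x) := by
    rintro s ⟨hs, hs1⟩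
    rcases hs1.eq_or_lt with rfl | hs1
    · simp
    · exact hlin s ⟨hs, hs1⟩
  -- Differentiate the linear relation in `s` at `r`, within `[0,1]` so that the endpoints are
  -- included.
  have hsum : W.starProjection (Matrix.toEuclideanLin (matA φ (r • x)) x) +
      W.starProjection (Matrix.toEuclideanLin (matB φ (r • x)) x) =
      W.starProjection (field φ x) := by
    have h1 : HasDerivAt (fun s : ℝ => s • x) x r := by
      simpa using (hasDerivAt_id r).smul_const x
    have h2 := W.starProjection.hasFDerivAt.comp_hasDerivAt r
      ((hasFDerivAt_field hC).comp_hasDerivAt r h1)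
    have h3 : HasDerivWithinAt (fun s : ℝ => s • W.starProjection (field φ x))
        (W.starProjection (field φ x)) (Icc 0 1) r := by
      simpa using ((hasDerivAt_id r).smul_const (W.starProjection (field φ x))).hasDerivWithinAt
    have h4 := (uniqueDiffOn_Icc one_pos r hr).eq_deriv _ h2.hasDerivWithinAt
      (h3.congr hlin' (hlin' r hr))
    rw [← h4, ← map_add]
    rfl
  have hself : ∀ v, inner ℝ (W.starProjection v) x = inner ℝ v x := fun v => by
    rw [Submodule.inner_starProjection_left_eq_right, Submodule.starProjection_eq_self_iff.2 hxW]
  have hB0 : inner ℝ (Matrix.toEuclideanLin (matB φ (r • x)) x) x = 0 := by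
    have h1 := congrArg (fun v => inner ℝ v x) hsum
    simpa [inner_add_left, hself, inner_matA_self hC, hx0] using h1
  -- A nonpositive quadratic form that vanishes at `x` has `x` in its kernel, relative to W.
  have hB : Matrix.toEuclideanLin (matB φ (r • x)) x ∈ Wᗮ := by
    rw [Submodule.mem_orthogonal']
    intro v hv
    have key : ∀ a : ℝ, 2 * a * inner ℝ (Matrix.toEuclideanLin (matB φ (r • x)) x) v +
        a ^ 2 * inner ℝ (Matrix.toEuclideanLin (matB φ (r • x)) v) v ≤ 0 := by
      intro a
      have h1 := inner_matB_self_nonpos hD hprod hcc (hKD hrx) hC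
        (hWD _ (Submodule.add_mem _ hxW (Submodule.smul_mem _ a hv)))
      rw [map_add, map_smul] at h1
      simp only [inner_add_left, inner_add_right, inner_smul_right, real_inner_smul_left, hB0] at h1
      rw [inner_matB_comm hC v x] at h1
      linarith
    by_contra h
    set p := inner ℝ (Matrix.toEuclideanLin (matB φ (r • x)) x) v with hp
    set q := inner ℝ (Matrix.toEuclideanLin (matB φ (r • x)) v) v with hq
    -- A small step in the direction of `p`; the denominator keeps the linear term dominant whatever
    -- the sign of `q`.
    have h1 := key (p / (1 + |q|))
    have h2 : 0 < 1 + |q| := by positivity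
    have h3 : 2 * (p / (1 + |q|)) * p + (p / (1 + |q|)) ^ 2 * q =
        p ^ 2 / (1 + |q|) ^ 2 * (2 * (1 + |q|) + q) := by
      field_simp
    rw [h3] at h1
    have h4 : 0 < 2 * (1 + |q|) + q := by linarith [neg_abs_le q, abs_nonneg q]
    have h5 : 0 < p ^ 2 / (1 + |q|) ^ 2 := by positivity
    exact absurd h1 (not_le.2 (mul_pos h5 h4))
  have hPB := (Submodule.starProjection_apply_eq_zero_iff (K := W)).2 hB
  rw [hPB, add_zero] at hsum
  exact ⟨by rw [hcomp, hPB], by rw [hcomp, hsum]⟩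

end Trajectories

end Subgradient

/-! ### The theorem. -/

open Subgradient
theorem mainTheorem4 {n m : ℕ} (K : Set (E n m)) (hKclosed : IsClosed K) (hKconvex : Convex ℝ K)
    (φ : E n m → ℝ) (hφ : ∀ z ∈ K, ContDiffAt ℝ 2 φ z) (hcc : ConcaveConvexOn φ K)
    (h0 : IsRestrictedSaddle φ K 0)
    (hno : ¬ ∃ z : ℝ → E n m, IsTrajectory φ K univ z ∧ (¬ ∃ c, ∀ t, z t = c) ∧
      (∀ t, HasDerivAt z (compress φ K (matA φ 0) (z t)) t) ∧
      (∀ r ∈ Icc (0 : ℝ) 1, ∀ t, z t ∈ LinearMap.ker (compress φ K (matB φ (r • z t))) ⊓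
        LinearMap.ker (compress φ K (matA φ (r • z t) - matA φ 0)))) :
    GloballyConvergent φ K := by
  intro z hz ε hε
  by_contra! hcon
  have hfc : ContinuousOn (field φ) K := fun x hx =>
    (hasFDerivAt_field (hφ x hx)).continuousAt.continuousWithinAt
  have hf := isDissipativeOn_field hKconvex hφ hcc
  have h0' : (0 : E n m) ∈ saddles (field φ) K := h0
  have hfreq : ∃ᶠ t in Filter.atTop, ∀ e ∈ saddles (field φ) K, ε ≤ dist (z t) e := by
    refine Filter.frequently_atTop.2 fun T => ?_
    obtain ⟨t, ht, h⟩ := hcon T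
    exact ⟨t, ht, fun e he => h e (isEquilibrium_of_mem_saddles he)⟩
  obtain ⟨e, he, w, hw, hnc, hface, hwW, hder, hww, hlin⟩ :=
    hz.isSolution.exists_linear_solution hKclosed hKconvex hfc hf h0' hε hfreq
  obtain ⟨D, hD, hKD, hprod, hs⟩ := hcc
  have hproj := proj_eq_starProjection hKconvex he h0' hface
  have hWD : ∀ v ∈ faceDirection hKconvex he.1, v ∈ vectorSpan ℝ D := by
    rintro v ⟨r, hr, h1, -⟩
    have h2 := vsub_mem_vectorSpan ℝ (hKD h1) (hKD he.1)
    rw [vsub_eq_sub, add_sub_cancel_left] at h2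
    exact (Submodule.smul_mem_iff _ hr.ne').1 h2
  have key := fun t r (hr : r ∈ Icc (0 : ℝ) 1) => compress_eq_of_linear hD hKD hprod hs hKconvex
    h0.1 hφ hWD hproj (hw.1 t trivial) (hwW t) (hww t) (hlin t) hr
  -- The case `r = 0` identifies the common value of the A-terms as the one at the origin.
  have hA0 : ∀ t, compress φ K (matA φ 0) (w t) =
      (faceDirection hKconvex he.1).starProjection (field φ (w t)) := fun t => by
    simpa using (key t 0 (by simp)).2
  refine hno ⟨w, hw.isTrajectory, hnc, fun t => ?_, fun r hr t => ⟨(key t r hr).1, ?_⟩⟩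
  · rw [hA0]
    exact hder t
  · have h1 : compress φ K (matA φ (r • w t) - matA φ 0) =
        compress φ K (matA φ (r • w t)) - compress φ K (matA φ 0) := by
      simp only [compress, map_sub, LinearMap.sub_comp, LinearMap.comp_sub]
    change compress φ K (matA φ (r • w t) - matA φ 0) (w t) = 0
    rw [h1, LinearMap.sub_apply, (key t r hr).2, hA0, sub_self]
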